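/- Let $C\subset\mathbb{R}^2$ be a plane convex body, that is, a compact convex set with non-empty interior. If $C$ is a parallelogram, then the spindle Carathéodory number and the ball Carathéodory number of $C$ are both equal to $2$; otherwise both are equal to $3$. Here a set $K\subseteq\mathbb{R}^2$ is called $C$-ball convex if $K=\emptyset$, or $K=\mathbb{R}^2$, or $K$ is the intersection of all translates of $C$ that contain $K$. For $p,q\in\mathbb{R}^2$ (not necessarily distinct), the $C$-spindle $[p,q]_C$ is the intersection of all translates of $C$ that contain both $p$ and $q$, and $[p,q]_C=\mathbb{R}^2$ if there is no such translate; $K$ is called $C$-spindle convex if $[p,q]_C\subseteq K$ for all $p,q\in K$. For a family $\mathcal{G}$ of subsets of $\mathbb{R}^2$ and $A\subseteq\mathbb{R}^2$, let $\operatorname{conv}_{\mathcal{G}}(A)$ be the intersection of all members of $\mathcal{G}$ that contain $A$. The Carathéodory number of $\mathcal{G}$ is the smallest positive integer $k$ such that for every closed set $V\subseteq\mathbb{R}^2$ and every $p\in\operatorname{conv}_{\mathcal{G}}(V)$ there is a set $W\subseteq V$ with at most $k$ elements and $p\in\operatorname{conv}_{\mathcal{G}}(W)$ (and $\infty$ if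 there is no such $k$). The spindle Carathéodory number of $C$ is the Carathéodory number of the family of all closed $C$-spindle convex sets, and the ball Carathéodory number of $C$ is that of the family of all $C$-ball convex sets. -/

import Mathlib

open scoped Pointwise

/-- A convex body: a compact convex set with non-empty interior. -/
def IsConvexBody {E : Type*} [AddCommGroup E] [Module ℝ E] [TopologicalSpace E]
    (C : Set E) : Prop :=
  IsCompact C ∧ Convex ℝ C ∧ (interior C).Nonempty

/-- A (nondegenerate) parallelogram: a translate of the set of all `s • u + t • v` with
`s, t ∈ [0, 1]`, where `u` and `v` are linearly independent. -/
def IsParallelogram {E : Type*} [AddCommGroup E] [Module ℝ E] (C : Set E) : Prop :=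
  ∃ a u v : E, LinearIndependent ℝ ![u, v] ∧ C = a +ᵥ parallelepiped ![u, v]

/-- The intersection of all translates of `C` that contain `A`. If there are no such translates,
this is the whole space. -/
def translateHull {E : Type*} [AddCommGroup E] (C A : Set E) : Set E :=
  ⋂ (u : E) (_ : A ⊆ u +ᵥ C), (u +ᵥ C)

/-- `K` is `C`-ball convex: it is empty, or the whole space, or the intersection of all
translates of `C` that contain it. -/
def IsBallConvex {E : Type*} [AddCommGroup E] (C K : Set E) : Prop :=
  K = ∅ ∨ K = Set.univ ∨ K = translateHull C K

/-- The `C`-spindle `[p, q]_C`: the intersection of all translates of `C` that contain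
`p` and `q`; the whole space if there are none. -/
def spindle {E : Type*} [AddCommGroup E] (C : Set E) (p q : E) : Set E :=
  translateHull C {p, q}

/-- `K` is `C`-spindle convex: it contains the `C`-spindle of any two (not necessarily distinct)
points of it. -/
def IsSpindleConvex {E : Type*} [AddCommGroup E] (C K : Set E) : Prop :=
  ∀ p ∈ K, ∀ q ∈ K, spindle C p q ⊆ K

/-- The hull of `A` in the convexity structure `G`: the intersection of the members of `G`
that contain `A`. -/
def structureHull {X : Type*} (G : Set (Set X)) (A : Set X) : Set X :=
  ⋂₀ {K | K ∈ G ∧ A ⊆ K}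

/-- The Carathéodory number of a convexity structure `G` on a topological space `X`: the smallest
positive integer `k` such that, for all closed `V ⊆ X`, each point of the hull of `V` is in the
hull of a subset of `V` with at most `k` points; it is `⊤` if there is no such `k`. -/
noncomputable def caratheodoryNumber {X : Type*} [TopologicalSpace X] (G : Set (Set X)) : ℕ∞ :=
  sInf ((fun k : ℕ => (k : ℕ∞)) '' {k : ℕ | 0 < k ∧
    ∀ V : Set X, IsClosed V → ∀ p ∈ structureHull G V,
      ∃ W ⊆ V, W.encard ≤ k ∧ p ∈ structureHull G W})

/-- The spindle Carathéodory number of `C`: that of the family of closed `C`-spindle convex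
sets. -/
noncomputable def spindleCaratheodoryNumber {E : Type*} [AddCommGroup E] [TopologicalSpace E]
    (C : Set E) : ℕ∞ :=
  caratheodoryNumber {K : Set E | IsClosed K ∧ IsSpindleConvex C K}

/-- The ball Carathéodory number of `C`: that of the family of `C`-ball convex sets. -/
noncomputable def ballCaratheodoryNumber {E : Type*} [AddCommGroup E] [TopologicalSpace E]
    (C : Set E) : ℕ∞ :=
  caratheodoryNumber {K : Set E | IsBallConvex C K}

open Filter Topology Set

/-! The two numbers agree because in the plane a closed set is spindle convex exactly when it is
ball convex (`isClosed_and_isSpindleConvex_iff`). If `p` is outside such a set `K`, separate them by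
a direction `n` in which `C` has a single top point `t`; these are dense, as the support function is
differentiable almost everywhere. Put `t` on a top point `x` of `K`. This translate contains every
`y ∈ K`: otherwise the spindle of `x` and `y` would rise above `x`, by `Convex.add_mem_of_isMax`. It
also excludes `p`.

The bound three is `exists_three_points`. If no translate contains `V`, Helly's theorem gives at
most three points of `V` in no common translate. Otherwise follow the ray from some `v₀ ∈ V` through
`p` to its last point `q` in the hull. Then `q` is on the boundary of some translate containing `V`,
and `Convex.exists_pair_of_mem_hull` puts `q` in the spindle of two points of `V`. Those two and
`v₀` suffice.

For a parallelogram in its own coordinates, the hull of a set that fits in a translate is its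
bounding box, and two of the four extreme points of the set already have `p` in their box.

Otherwise, consider the outer normals at smooth boundary points. They form a positively spanning
cone. If no three of them, not all parallel, sum to zero, the cone is symmetric
(`Plane.neg_mem_of_no_triple`) and consists of two lines through the origin, so `C` is a
parallelogram. If three do, a small triangle with edges normal to them has its centroid in the hull
of the vertices, while near the smooth points `C` looks like a half-plane and cuts the centroid off
from each edge. -/

/-- The Euclidean plane. -/
abbrev Plane := EuclideanSpace ℝ (Fin 2)

/-! ### Linear algebra of the plane -/

namespace Plane

/-- The determinant of two vectors of the plane. -/
def det (v w : Plane) : ℝ := v 0 * w 1 - v 1 * w 0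

lemma ext_coord {v w : Plane} (h0 : v 0 = w 0) (h1 : v 1 = w 1) : v = w := by
  ext i; fin_cases i <;> assumption

lemma exists_eq_smul_of_det_eq_zero {v w : Plane} (hv : v ≠ 0) (h : det v w = 0) :
    ∃ r : ℝ, w = r • v := by
  unfold det at h
  by_cases h0 : v 0 = 0
  · have h1 : v 1 ≠ 0 := fun h1 => hv (ext_coord (by simpa using h0) (by simpa using h1))
    refine ⟨w 1 / v 1, ext_coord ?_ ?_⟩
    · simp only [h0, zero_mul, zero_sub, neg_eq_zero, mul_eq_zero] at h
      simp [h0, h.resolve_left h1]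
    · simp [h1]
  · refine ⟨w 0 / v 0, ext_coord ?_ ?_⟩
    · simp [h0]
    · simp only [PiLp.smul_apply, smul_eq_mul]
      field_simp
      linarith

lemma apply_eq (n : Plane →L[ℝ] ℝ) (x : Plane) :
    n x = n (EuclideanSpace.single 0 1) * x 0 + n (EuclideanSpace.single 1 1) * x 1 := by
  have : x = x 0 • EuclideanSpace.single 0 (1 : ℝ) + x 1 • EuclideanSpace.single 1 (1 : ℝ) := by
    apply ext_coord <;> simp
  conv_lhs => rw [this]
  simp only [map_add, map_smul, smul_eq_mul]; ring

/-- The kernel of a non-zero functional on the plane is spanned by each of its non-zero vectors. -/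
lemma exists_eq_smul_of_apply_eq_zero {n : Plane →L[ℝ] ℝ} (hn : n ≠ 0) {e w : Plane} (he : e ≠ 0)
    (hne : n e = 0) (hnw : n w = 0) : ∃ r : ℝ, w = r • e := by
  apply exists_eq_smul_of_det_eq_zero he
  rw [apply_eq] at hne hnw
  set a := n (EuclideanSpace.single 0 1)
  set b := n (EuclideanSpace.single 1 1)
  have h1 : a * det e w = 0 := by unfold det; linear_combination w 1 * hne - e 1 * hnw
  have h2 : b * det e w = 0 := by unfold det; linear_combination e 0 * hnw - w 0 * hne
  by_contra h
  apply hn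
  ext x
  have ha : a = 0 := (mul_eq_zero.1 h1).resolve_right h
  have hb : b = 0 := (mul_eq_zero.1 h2).resolve_right h
  rw [apply_eq]
  change a * x 0 + b * x 1 = 0
  simp [ha, hb]

/-- A functional on the plane has a non-zero vector in its kernel. -/
lemma exists_ne_zero_apply_eq_zero (n : Plane →L[ℝ] ℝ) : ∃ d : Plane, d ≠ 0 ∧ n d = 0 := by
  set a := n (EuclideanSpace.single 0 1) with ha
  set b := n (EuclideanSpace.single 1 1) with hb
  by_cases h : a = 0
  · exact ⟨EuclideanSpace.single 0 1, by simp, by rw [← ha, h]⟩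
  · refine ⟨!₂[-b, a], fun h0 => h (by simpa using congrArg (fun v : Plane => v 1) h0), ?_⟩
    rw [apply_eq, ← ha, ← hb]
    simp; ring

lemma exists_apply_eq_one {n : Plane →L[ℝ] ℝ} (hn : n ≠ 0) : ∃ e : Plane, n e = 1 := by
  obtain ⟨x, hx⟩ : ∃ x, n x ≠ 0 := by
    by_contra! h; exact hn (by ext x; simpa using h x)
  exact ⟨(n x)⁻¹ • x, by simp [hx]⟩

/-- A line through `t` in direction `w` meets the segment from `y` to `z`, or `y` and `z` lie
strictly on the same side of it. -/
lemma line_meets_segment_or {w : Plane} (hw : w ≠ 0) (t y z : Plane) :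
    (∃ σ : ℝ, t + σ • w ∈ segment ℝ y z) ∨
      ∃ l : ℝ, 0 < l ∧ ∃ τ : ℝ, y - t = l • (z - t) + τ • w := by
  have add (a b c : Plane) (r : ℝ) : det a (b + r • c) = det a b + r * det a c := by
    simp [det]; ring
  have sub (a b c : Plane) (r : ℝ) : det a (b - r • c) = det a b - r * det a c := by
    simp [det]; ring
  -- `p` and `q` are the signed offsets of `y` and `z` from the line; their signs decide between the
  -- alternatives.
  set p := det w (y - t) with hp
  set q := det w (z - t) with hq
  by_cases hpq : 0 < p * q
  · right
    have hq0 : q ≠ 0 := fun h => by simp [h] at hpq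
    refine ⟨p / q, ?_, ?_⟩
    · have : p / q = p * q / q ^ 2 := by field_simp
      rw [this]; positivity
    · obtain ⟨τ, hτ⟩ := exists_eq_smul_of_det_eq_zero hw
        (w := (y - t) - (p / q) • (z - t)) (by rw [sub, ← hp, ← hq]; field_simp; ring)
      exact ⟨τ, by rw [← hτ]; abel⟩
  · left
    have key : ∃ a b : ℝ, 0 ≤ a ∧ 0 ≤ b ∧ a + b = 1 ∧ a * p + b * q = 0 := by
      by_cases h : p = q
      · refine ⟨1, 0, by norm_num, by norm_num, by norm_num, ?_⟩
        rw [h] at hpq ⊢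
        nlinarith [mul_self_nonneg q, mul_self_eq_zero.1 (le_antisymm (not_lt.1 hpq)
          (mul_self_nonneg q))]
      · have h' : p - q ≠ 0 := sub_ne_zero.2 h
        have h2 : 0 < (p - q) ^ 2 := by positivity
        refine ⟨-q / (p - q), p / (p - q), ?_, ?_, ?_, ?_⟩
        · have : -q / (p - q) = (q ^ 2 - p * q) / (p - q) ^ 2 := by field_simp; ring
          rw [this]; apply div_nonneg _ h2.le; nlinarith [sq_nonneg q]
        · have : p / (p - q) = (p ^ 2 - p * q) / (p - q) ^ 2 := by field_simp
          rw [this]; apply div_nonneg _ h2.le; nlinarith [sq_nonneg p]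
        · field_simp; ring
        · field_simp; ring
    obtain ⟨a, b, ha, hb, hab, h⟩ := key
    obtain ⟨σ, hσ⟩ := exists_eq_smul_of_det_eq_zero hw
      (w := a • (y - t) + b • (z - t)) (by
        rw [add, show det w (a • (y - t)) = a * p by simp [det, hp]; ring, ← hq, h])
    refine ⟨σ, a, b, ha, hb, hab, ?_⟩
    obtain rfl : b = 1 - a := by linarith
    rw [← hσ]
    module

end Plane

/-! ### Shifting points within a convex set -/

section Translates

variable {F : Type*} [AddCommGroup F] [Module ℝ F]

lemma Convex.add_smul_mem_of_le {C : Set F} (hC : Convex ℝ C) {v w : F} (hv : v ∈ C) {s r : ℝ}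
    (hr : v + r • w ∈ C) (hs : 0 ≤ s) (hsr : s ≤ r) : v + s • w ∈ C := by
  rcases hs.eq_or_lt with rfl | hs
  · simpa using hv
  have hr0 : 0 < r := hs.trans_le hsr
  have := hC.add_smul_mem hv hr (t := s / r) ⟨by positivity, by rw [div_le_one hr0]; exact hsr⟩
  rwa [smul_smul, div_mul_cancel₀ _ hr0.ne'] at this

lemma Convex.combo3_mem {C : Set F} (hC : Convex ℝ C) {x y z : F} (hx : x ∈ C) (hy : y ∈ C)
    (hz : z ∈ C) {b c : ℝ} (hb : 0 ≤ b) (hc : 0 ≤ c) (h : b + c ≤ 1) :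
    x + b • (y - x) + c • (z - x) ∈ C := by
  have := hC.sum_mem (t := Finset.univ) (w := ![1 - b - c, b, c]) (z := ![x, y, z])
    (by intro i _; fin_cases i <;> simp <;> linarith)
    (by simp [Fin.sum_univ_three]; ring) (by intro i _; fin_cases i <;> simp [*])
  convert this using 1
  simp [Fin.sum_univ_three]
  module

/-- If a convex set contains `y`, `z`, `t` and the shifts by `w` of `y` and `z`, and the ray
from `t` in direction `w` meets the segment from `y` to `z`, then it contains `t + w`. -/
lemma Convex.add_mem_of_ray_meets_segment {C : Set F} (hC : Convex ℝ C) {y z t w : F}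
    (hy : y ∈ C) (hz : z ∈ C) (ht : t ∈ C) (hyw : y + w ∈ C) (hzw : z + w ∈ C) {σ : ℝ}
    (hσ : 0 ≤ σ) (h : t + σ • w ∈ segment ℝ y z) : t + w ∈ C := by
  have hm : t + σ • w ∈ C := hC.segment_subset hy hz h
  have hmw : t + σ • w + w ∈ C := by
    obtain ⟨a, b, ha, hb, hab, h⟩ := h
    have := hC hyw hzw ha hb hab
    rw [← h]
    convert this using 1
    rw [smul_add, smul_add]
    have : w = a • w + b • w := by rw [← add_smul, hab, one_smul]
    nth_rw 1 [this]; abel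
  -- `t + w` lies between `t` and `t + σ • w` if `1 ≤ σ`, and otherwise between `t + σ • w` and its
  -- shift by `w`.
  rcases le_total 1 σ with h1 | h1
  · simpa using hC.add_smul_mem_of_le ht hm zero_le_one h1
  · have := hC.add_smul_mem_of_le hm (s := 1 - σ) (r := 1) (by simpa using hmw) (by linarith)
      (by linarith)
    convert this using 1
    module

end Translates

/-- If `C` cannot be moved down so that it still contains `y` and `z`, which lie strictly below a
top point `t` of `C`, then every translate of `C` that contains `y` and `z` contains `t`. -/
lemma Convex.add_mem_of_isMax {C : Set Plane} (hC : Convex ℝ C) {n : Plane →L[ℝ] ℝ} {y z t : Plane}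
    (hy : y ∈ C) (hz : z ∈ C) (ht : t ∈ C) (hny : n y < n t) (hnz : n z < n t)
    (hmin : ∀ w, y + w ∈ C → z + w ∈ C → n w ≤ 0) {w : Plane} (hyw : y + w ∈ C)
    (hzw : z + w ∈ C) : t + w ∈ C := by
  by_cases hw : w = 0
  · simpa [hw] using ht
  rcases Plane.line_meets_segment_or hw t y z with ⟨σ, hσ⟩ | ⟨l, hl, τ, h⟩
  · refine hC.add_mem_of_ray_meets_segment hy hz ht hyw hzw ?_ hσ
    have h1 : n (t + σ • w) < n t := by
      obtain ⟨a, b, ha, hb, hab, h⟩ := hσ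
      rw [← h, map_add, map_smul, map_smul, smul_eq_mul, smul_eq_mul]
      have hb' : b = 1 - a := by linarith
      subst hb'
      rcases ha.eq_or_lt with rfl | ha
      · simpa using hnz
      · nlinarith
    have h2 := hmin w hyw hzw
    simp only [map_add, map_smul, smul_eq_mul] at h1
    by_contra! h3
    nlinarith
  -- With `y` and `z` on one side of the line, `l • (t - z) = (t - y) + τ • w`. According to the
  -- sign of `τ`, one side of this identity, or of its rearrangement for `t - y`, combines moves
  -- available at `y` and the other those at `z`. Both points can thus move up together; `s` keeps
  -- the convex weights at most one.
  · exfalso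
    rcases le_total 0 τ with hτ | hτ
    · -- moving both points towards `t - z`
      set s := (1 + τ + l)⁻¹ with hs
      have hs0 : 0 < s := by positivity
      have hsl : s * (1 + τ + l) = 1 := inv_mul_cancel₀ (by positivity)
      have h1 := hmin ((s * l) • (t - z)) ?_ ?_
      · simp only [map_smul, map_sub, smul_eq_mul] at h1
        have : 0 < s * l * (n t - n z) := by
          apply mul_pos (by positivity); linarith
        linarith
      · have := hC.combo3_mem hy ht hyw (b := s) (c := s * τ) hs0.le (by positivity) (by nlinarith)
        convert this using 1
        have h2 : l • (t - z) = (t - y) + τ • w := by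
          have : l • (t - z) = - (l • (z - t)) := by module
          rw [this, eq_sub_of_add_eq h.symm]; module
        rw [mul_smul, h2]; module
      · exact hC.add_smul_sub_mem hz ht ⟨by positivity, by nlinarith⟩
    · set s := (1 - τ + l)⁻¹ with hs
      have hs0 : 0 < s := by apply inv_pos.2; linarith
      have hsl : s * (1 - τ + l) = 1 := inv_mul_cancel₀ (by linarith)
      have h1 := hmin (s • (t - y)) ?_ ?_
      · simp only [map_smul, map_sub, smul_eq_mul] at h1
        have : 0 < s * (n t - n y) := by
          apply mul_pos (by positivity); linarith
        linarith
      · exact hC.add_smul_sub_mem hy ht ⟨by positivity, by nlinarith⟩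
      · have := hC.combo3_mem hz ht hzw (b := s * l) (c := s * (-τ)) (by positivity)
          (mul_nonneg hs0.le (by linarith)) (by nlinarith)
        convert this using 1
        have h2 : t - y = l • (t - z) + (-τ) • w := by
          have : t - y = - (y - t) := by abel
          rw [this, h]; module
        rw [h2]; module

/-- Planar convex bodies are locally stable: if `v` and `v + w` lie in `C`, then every shift
`v' + s • w` with `s < 1` of a point `v'` of `C` close to `v` lies in `C`. -/
lemma Convex.eventually_add_smul_mem {C : Set Plane} (hC : Convex ℝ C) (hi : (interior C).Nonempty)
    {v w : Plane} (hv : v ∈ C) (hvw : v + w ∈ C) {s : ℝ} (hs0 : 0 ≤ s) (hs1 : s < 1) :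
    ∀ᶠ v' in 𝓝[C] v, v' + s • w ∈ C := by
  rcases hs0.eq_or_lt with rfl | hs0
  · simpa using eventually_mem_nhdsWithin
  by_cases hw : w = 0
  · simpa [hw] using eventually_mem_nhdsWithin
  by_cases hint : v + s • w ∈ interior C
  · have hcont : Tendsto (fun v' : Plane => v' + s • w) (𝓝[C] v) (𝓝 (v + s • w)) := by
      apply Tendsto.mono_left _ nhdsWithin_le_nhds
      exact (continuous_id.add continuous_const).tendsto v
    filter_upwards [hcont.eventually (isOpen_interior.mem_nhds hint)] with v' h
      using interior_subset h
  obtain ⟨f, hf⟩ := geometric_hahn_banach_open_point hC.interior isOpen_interior hint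
  have hfC : ∀ x ∈ C, f x ≤ f (v + s • w) := by
    intro x hx
    have hx' : x ∈ closure (interior C) := by
      rw [hC.closure_interior_eq_closure_of_nonempty_interior hi]; exact subset_closure hx
    exact closure_minimal (t := {x | f x ≤ f (v + s • w)}) (fun a ha => (hf a ha).le)
      (isClosed_le f.continuous continuous_const) hx'
  obtain ⟨c, hc⟩ := hi
  have h1 := hfC v hv
  have h2 := hfC _ hvw
  have h3 := hf c hc
  simp only [map_add, map_smul, smul_eq_mul] at h1 h2 h3
  -- `f` is maximal on `C` at a point strictly between `v` and `v + w`, so it is constant along `w`.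
  have hfw : f w = 0 := by nlinarith
  rw [hfw, mul_zero, add_zero] at h3
  have hf0 : f ≠ 0 := by rintro rfl; simp at h3
  -- Coordinates `x = v + a x • w + b x • (c - v)`, with `b ≥ 0` on `C`. Near `v` both are small, so
  -- `x + s • w` is a convex combination of `v`, `v + w` and `c`.
  set b : Plane → ℝ := fun x => f (x - v) / f (c - v) with hb
  have hfcv : f (c - v) < 0 := by rw [map_sub]; linarith
  choose a ha using fun x : Plane => Plane.exists_eq_smul_of_apply_eq_zero hf0 hw hfw
    (w := x - v - b x • (c - v)) (by
      rw [map_sub, map_smul, smul_eq_mul, hb]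
      simp only
      rw [div_mul_cancel₀ _ hfcv.ne, sub_self])
  have ha' : a = fun x => inner ℝ w (x - v - b x • (c - v)) / ‖w‖ ^ 2 := by
    funext x
    rw [ha x, inner_smul_right, real_inner_self_eq_norm_sq]
    have : ‖w‖ ≠ 0 := norm_ne_zero_iff.2 hw
    field_simp
  have hbc : Continuous b := by
    apply Continuous.div_const
    exact f.continuous.comp (continuous_id.sub continuous_const)
  have hac : Continuous a := by
    rw [ha']
    apply Continuous.div_const
    apply continuous_const.inner
    exact (continuous_id.sub continuous_const).sub (hbc.smul continuous_const)
  have hbv : b v = 0 := by simp [hb]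
  have hav : a v = 0 := by rw [ha']; simp [hbv]
  have e1 : ∀ᶠ x in 𝓝[C] v, 0 < s + a x := by
    apply nhdsWithin_le_nhds
    have : Continuous fun x => s + a x := continuous_const.add hac
    exact this.continuousAt.eventually (lt_mem_nhds (by simp [hav, hs0]))
  have e2 : ∀ᶠ x in 𝓝[C] v, s + a x + b x < 1 := by
    apply nhdsWithin_le_nhds
    have : Continuous fun x => s + a x + b x := (continuous_const.add hac).add hbc
    exact this.continuousAt.eventually (gt_mem_nhds (by simp [hav, hbv, hs1]))
  filter_upwards [e1, e2, eventually_mem_nhdsWithin] with x h1 h2 hx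
  have hbx : 0 ≤ b x := by
    apply div_nonneg_of_nonpos _ hfcv.le
    have := hfC x hx
    rw [map_add, map_smul, hfw, smul_zero, add_zero] at this
    rw [map_sub]; linarith
  have := hC.combo3_mem hv hvw (interior_subset hc) h1.le hbx h2.le
  convert this using 1
  have hx := ha x
  rw [sub_eq_iff_eq_add, sub_eq_iff_eq_add] at hx
  nth_rw 1 [hx]
  module

/-- If each point of a compact part `V` of a planar convex body `C` can be moved in direction `w`
within `C`, then `V` can be. -/
lemma Convex.exists_uniform_shift {C : Set Plane} (hC : Convex ℝ C) (hi : (interior C).Nonempty)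
    {V : Set Plane} (hV : IsCompact V) (hVC : V ⊆ C) {w : Plane}
    (h : ∀ v ∈ V, ∃ s : ℝ, 0 < s ∧ v + s • w ∈ C) :
    ∃ s : ℝ, 0 < s ∧ ∀ v ∈ V, v + s • w ∈ C := by
  refine hV.induction_on (p := fun S => ∃ s : ℝ, 0 < s ∧ ∀ v ∈ S, v ∈ V → v + s • w ∈ C) ?_ ?_ ?_ ?_
    |>.imp fun s hs => ⟨hs.1, fun v hv => hs.2 v hv hv⟩
  · exact ⟨1, one_pos, by simp⟩
  · rintro S T hST ⟨s, hs, hT⟩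
    exact ⟨s, hs, fun v hv => hT v (hST hv)⟩
  · rintro S T ⟨s, hs, hS⟩ ⟨t, ht, hT⟩
    refine ⟨min s t, lt_min hs ht, ?_⟩
    rintro v (hv | hv) hvV
    · exact hC.add_smul_mem_of_le (hVC hvV) (hS v hv hvV) (le_min hs.le ht.le) (min_le_left _ _)
    · exact hC.add_smul_mem_of_le (hVC hvV) (hT v hv hvV) (le_min hs.le ht.le) (min_le_right _ _)
  · intro v hv
    obtain ⟨s, hs, hvs⟩ := h v hv
    -- Stability needs a strictly shorter shift; half of it will do.
    have := hC.eventually_add_smul_mem hi (hVC hv) hvs (s := 1 / 2) (by norm_num) (by norm_num)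
    refine ⟨_, nhdsWithin_mono v hVC this, s / 2, by positivity, fun v' hv' _ => ?_⟩
    have h' : v' + (1 / 2 : ℝ) • s • w ∈ C := hv'
    rw [smul_smul] at h'
    convert h' using 3
    ring

/-- If any two points of a compact part `V` of a planar convex body can be moved together in a
direction in which `n` increases, then so can `V`. -/
lemma Convex.exists_common_shift {C : Set Plane} (hC : Convex ℝ C) (hi : (interior C).Nonempty)
    {V : Set Plane} (hV : IsCompact V) (hVC : V ⊆ C) {n : Plane →L[ℝ] ℝ} (hn : n ≠ 0)
    (h : ∀ y ∈ V, ∀ z ∈ V, ∃ w, 0 < n w ∧ y + w ∈ C ∧ z + w ∈ C) :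
    ∃ w, 0 < n w ∧ ∀ v ∈ V, v + w ∈ C := by
  obtain ⟨e, he⟩ := Plane.exists_apply_eq_one hn
  rcases V.eq_empty_or_nonempty with rfl | ⟨v₀, hv₀⟩
  · exact ⟨e, by simp [he], by simp⟩
  obtain ⟨k, hk0, hk⟩ := Plane.exists_ne_zero_apply_eq_zero n
  -- Slopes of the upward directions in which `v` can move. These are pairwise intersecting
  -- intervals, so a one-dimensional Helly argument applies.
  set I : Plane → Set ℝ := fun v => {x | ∃ s : ℝ, 0 < s ∧ v + s • (e + x • k) ∈ C} with hI
  have hconv : ∀ v ∈ C, Convex ℝ (I v) := by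
    rintro v hv x₁ ⟨s₁, h₁, hs₁⟩ x₂ ⟨s₂, h₂, hs₂⟩ a b ha hb hab
    refine ⟨min s₁ s₂, lt_min h₁ h₂, ?_⟩
    have m₁ := hC.add_smul_mem_of_le hv hs₁ (le_min h₁.le h₂.le) (min_le_left _ _)
    have m₂ := hC.add_smul_mem_of_le hv hs₂ (le_min h₁.le h₂.le) (min_le_right _ _)
    convert hC m₁ m₂ ha hb hab using 1
    obtain rfl : b = 1 - a := by linarith
    simp only [smul_eq_mul]
    module
  have hopen : ∀ v ∈ V, ∀ x ∈ I v, ∀ᶠ v' in 𝓝[V] v, x ∈ I v' := by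
    rintro v hv x ⟨s, hs, hx⟩
    have := hC.eventually_add_smul_mem hi (hVC hv) hx (s := 1 / 2) (by norm_num) (by norm_num)
    filter_upwards [nhdsWithin_mono v hVC this] with v' hv'
    exact ⟨1 / 2 * s, by positivity, by rwa [mul_smul]⟩
  have hpair : ∀ y ∈ V, ∀ z ∈ V, ∃ x, x ∈ I y ∧ x ∈ I z := by
    intro y hy z hz
    obtain ⟨w, hw, hyw, hzw⟩ := h y hy z hz
    obtain ⟨r, hr⟩ := Plane.exists_eq_smul_of_apply_eq_zero hn hk0 hk (w := w - n w • e) (by simp [he])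
    have hw' : w = n w • (e + (r / n w) • k) := by
      rw [smul_add, smul_smul, mul_div_cancel₀ _ hw.ne', ← hr]; abel
    exact ⟨r / n w, ⟨n w, hw, by rwa [← hw']⟩, ⟨n w, hw, by rwa [← hw']⟩⟩
  -- The intervals need not be closed; compactness of `V × V` instead leaves finitely many slopes to
  -- consider.
  obtain ⟨X, hX⟩ : ∃ X : Finset ℝ, ∀ y ∈ V, ∀ z ∈ V, ∃ x ∈ X, x ∈ I y ∧ x ∈ I z := by
    refine (hV.prod hV).induction_on (p := fun S => ∃ X : Finset ℝ, ∀ q ∈ S, ∃ x ∈ X,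
      x ∈ I q.1 ∧ x ∈ I q.2) ?_ ?_ ?_ ?_ |>.imp fun X hX y hy z hz => hX (y, z) ⟨hy, hz⟩
    · exact ⟨∅, by simp⟩
    · rintro S T hST ⟨X, hX⟩
      exact ⟨X, fun q hq => hX q (hST hq)⟩
    · classical
      rintro S T ⟨X, hX⟩ ⟨Y, hY⟩
      refine ⟨X ∪ Y, ?_⟩
      rintro q (hq | hq)
      · obtain ⟨x, hx, h⟩ := hX q hq
        exact ⟨x, Finset.mem_union_left _ hx, h⟩
      · obtain ⟨x, hx, h⟩ := hY q hq
        exact ⟨x, Finset.mem_union_right _ hx, h⟩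
    · rintro ⟨y, z⟩ ⟨hy, hz⟩
      obtain ⟨x, hxy, hxz⟩ := hpair y hy z hz
      refine ⟨{q | x ∈ I q.1 ∧ x ∈ I q.2}, ?_, {x}, by simp⟩
      rw [nhdsWithin_prod_eq]
      exact (hopen y hy x hxy).prod_mk (hopen z hz x hxz)
  classical
  obtain ⟨x, hx⟩ : ∃ x, ∀ v ∈ V, x ∈ I v := by
    -- The least of the largest slopes is common to all: `I v` holds its own maximum, which is no
    -- smaller, and a slope shared with the minimizing `u`, which is no larger.
    set M : Finset ℝ := X.filter fun x => ∃ v ∈ V, x ∈ I v ∧ ∀ x' ∈ X, x' ∈ I v → x' ≤ x with hM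
    have hmax : ∀ v ∈ V, ∃ x ∈ M, x ∈ I v := by
      intro v hv
      obtain ⟨x₀, hx₀, hx₀v, -⟩ := hX v hv v hv
      obtain ⟨x, hx, hmax⟩ := (X.filter fun x => x ∈ I v).exists_max_image id
        ⟨x₀, by simp [hx₀, hx₀v]⟩
      simp only [Finset.mem_filter, id] at hx hmax
      exact ⟨x, by simpa [hM] using ⟨hx.1, v, hv, hx.2, fun x' h1 h2 => hmax x' ⟨h1, h2⟩⟩, hx.2⟩
    obtain ⟨x₀, hx₀, -⟩ := hmax v₀ hv₀
    obtain ⟨x, hx, hmin⟩ := M.exists_min_image id ⟨x₀, hx₀⟩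
    refine ⟨x, fun v hv => ?_⟩
    obtain ⟨y, hyM, hyv⟩ := hmax v hv
    obtain ⟨-, u, hu, -, humax⟩ := Finset.mem_filter.1 hx
    obtain ⟨x', hx', hx'v, hx'u⟩ := hX v hv u hu
    exact (hconv v (hVC hv)).ordConnected.out hx'v hyv ⟨humax x' hx' hx'u, hmin y hyM⟩
  obtain ⟨s, hs, hsV⟩ := hC.exists_uniform_shift hi hV hVC hx
  exact ⟨s • (e + x • k), by simpa [he, hk] using hs, hsV⟩

/-- A line meets a compact set in a compact set of parameters. -/
lemma IsCompact.line_preimage {S : Set Plane} (hS : IsCompact S) (v : Plane) {e : Plane}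
    (he : e ≠ 0) : IsCompact {s : ℝ | v + s • e ∈ S} := by
  refine Metric.isCompact_of_isClosed_isBounded (hS.isClosed.preimage (by fun_prop)) ?_
  have hanti : AntilipschitzWith (‖e‖₊⁻¹) (fun s : ℝ => v + s • e) := by
    apply AntilipschitzWith.of_le_mul_dist
    intro s t
    simp only [dist_add_left, NNReal.coe_inv, coe_nnnorm]
    rw [dist_eq_norm (s • e), ← sub_smul, norm_smul, dist_eq_norm]
    have : ‖e‖ ≠ 0 := norm_ne_zero_iff.2 he
    field_simp
    rfl
  exact hanti.isBounded_preimage hS.isBounded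

/-- Let `q` and `v₀` be points of a top edge of `C`. If for each `v ∈ V` some translate of `C`
contains `v₀` and `v` but not `q`, then `V` can be moved within `C` along the edge from `v₀`
towards `q`. -/
lemma Convex.exists_shift_along_edge {C : Set Plane} (hC : Convex ℝ C)
    (hi : (interior C).Nonempty) {V : Set Plane} (hV : IsCompact V) (hVC : V ⊆ C)
    {n : Plane →L[ℝ] ℝ} (hn : n ≠ 0) {q v₀ : Plane} (hq : q ∈ C) (hv₀ : v₀ ∈ C)
    (hmax : ∀ x ∈ C, n x ≤ n q) (hnq : n v₀ = n q) (hne : v₀ ≠ q)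
    (h : ∀ v ∈ V, ∃ w, v₀ + w ∈ C ∧ v + w ∈ C ∧ q + w ∉ C) :
    ∃ s : ℝ, 0 < s ∧ ∀ v ∈ V, v + s • (q - v₀) ∈ C := by
  refine hC.exists_uniform_shift hi hV hVC fun v hv => ?_
  obtain ⟨w, h0w, hvw, hqw⟩ := h v hv
  have hvC := hVC hv
  have hnw : n w ≤ 0 := by
    have := hmax _ h0w
    rw [map_add] at this; linarith
  rcases hnw.lt_or_eq with hnw | hnw
  · have hw0 : w ≠ 0 := by rintro rfl; simp at hnw
    -- Meeting the segment would force `q + w ∈ C`. Otherwise `q - v₀ = l • (q - v) + (-τ) • w`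
    -- combines two moves available at `v`.
    rcases Plane.line_meets_segment_or hw0 q v₀ v with ⟨σ, hσ⟩ | ⟨l, hl, τ, hlt⟩
    · refine absurd (hC.add_mem_of_ray_meets_segment hv₀ hvC hq h0w hvw ?_ hσ) hqw
      have := hmax _ (hC.segment_subset hv₀ hvC hσ)
      simp only [map_add, map_smul, smul_eq_mul] at this
      by_contra! hσ
      nlinarith
    · have hτ : τ ≤ 0 := by
        have h1 := congrArg n hlt
        simp only [map_add, map_sub, map_smul, smul_eq_mul] at h1
        have h2 := hmax v hvC
        by_contra! hτ
        nlinarith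
      set s := (l - τ)⁻¹ with hs
      have hs0 : 0 < s := by apply inv_pos.2; linarith
      have hsl : s * (l - τ) = 1 := inv_mul_cancel₀ (by linarith)
      refine ⟨s, hs0, ?_⟩
      have := hC.combo3_mem hvC hq hvw (b := s * l) (c := s * (-τ)) (by positivity)
        (mul_nonneg hs0.le (by linarith)) (by nlinarith)
      convert this using 1
      have h2 : q - v₀ = l • (q - v) + (-τ) • w := by
        have : q - v₀ = - (v₀ - q) := by abel
        rw [this, hlt]; module
      rw [h2]; module
  · obtain ⟨r, hr⟩ := Plane.exists_eq_smul_of_apply_eq_zero hn (sub_ne_zero.2 hne.symm)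
      (by rw [map_sub, hnq, sub_self]) hnw
    refine ⟨r, ?_, hr ▸ hvw⟩
    by_contra! hr0
    apply hqw
    rw [hr]
    have h1 : q + (1 - r) • (v₀ - q) ∈ C := by
      convert h0w using 1
      rw [hr]; module
    have := hC.add_smul_mem_of_le hq h1 (s := -r) (by linarith) (by linarith)
    convert this using 1
    module

/-- A boundary point `q` of a translate `C` containing `V`, which lies in every translate
containing `V`, lies in the spindle of two points of `V`. -/
lemma Convex.exists_pair_of_mem_hull {C : Set Plane} (hC : Convex ℝ C) (hc : IsCompact C)
    (hi : (interior C).Nonempty) {V : Set Plane} (hV : IsCompact V) (hVC : V ⊆ C)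
    {n : Plane →L[ℝ] ℝ} (hn : n ≠ 0) {q : Plane} (hq : q ∈ C) (hmax : ∀ x ∈ C, n x ≤ n q)
    (hhull : ∀ w, (∀ v ∈ V, v + w ∈ C) → q + w ∈ C) :
    ∃ y ∈ V, ∃ z ∈ V, ∀ w, y + w ∈ C → z + w ∈ C → q + w ∈ C := by
  by_cases hface : ∃ v₀ ∈ V, n v₀ = n q
  · obtain ⟨v₀, hv₀, hnv⟩ := hface
    by_contra! hno
    have hne : v₀ ≠ q := by
      rintro rfl
      obtain ⟨w, h1, -, h2⟩ := hno v₀ hv₀ v₀ hv₀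
      exact h2 h1
    set e := q - v₀ with he
    have he0 : e ≠ 0 := sub_ne_zero.2 hne.symm
    set S : Set ℝ := {s | 0 ≤ s ∧ ∀ v ∈ V, v + s • e ∈ C} with hS
    have hScl : IsClosed S := by
      have : S = Ici 0 ∩ ⋂ v ∈ V, (fun s : ℝ => v + s • e) ⁻¹' C := by
        ext s; simp [hS]
      rw [this]
      refine isClosed_Ici.inter (isClosed_iInter fun v => isClosed_iInter fun _ => ?_)
      exact hc.isClosed.preimage (by fun_prop)
    obtain ⟨s, ⟨hs0, hsV⟩, hsmax⟩ := 
      ((hc.line_preimage v₀ he0).of_isClosed_subset hScl fun s hs => hs.2 v₀ hv₀).exists_isGreatest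
      ⟨0, le_rfl, fun v hv => by simpa using hVC hv⟩
    obtain ⟨r, hr0, hr⟩ := hC.exists_shift_along_edge hi (V := (fun v => v + s • e) '' V)
      (hV.image (by fun_prop)) (by rintro _ ⟨v, hv, rfl⟩; exact hsV v hv) hn
      (q := q + s • e) (v₀ := v₀ + s • e) (hhull _ hsV) (hsV v₀ hv₀)
      (by intro x hx; simpa [he, hnv] using hmax x hx) (by simp [hnv]) (by simpa using hne)
      (by
        rintro _ ⟨v, hv, rfl⟩
        obtain ⟨w, h1, h2, h3⟩ := hno v₀ hv₀ v hv
        refine ⟨w - s • e, ?_, ?_, ?_⟩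
        · convert h1 using 1; abel
        · convert h2 using 1; beta_reduce; abel
        · convert h3 using 2; abel)
    have : s + r ∈ S := by
      refine ⟨by linarith, fun v hv => ?_⟩
      convert hr _ ⟨v, hv, rfl⟩ using 1
      rw [he]; module
    have := hsmax this
    linarith
  · push Not at hface
    have hlt : ∀ v ∈ V, n v < n q := fun v hv => lt_of_le_of_ne (hmax v (hVC hv)) (hface v hv)
    by_contra! hno
    -- A pair that cannot move up together would have `q` in its spindle. So every pair can, hence
    -- so can `V`, which carries `q` above the top of `C`.
    obtain ⟨w, hw, hwV⟩ := hC.exists_common_shift hi hV hVC hn (by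
      intro y hy z hz
      by_contra! hyz
      obtain ⟨w, h1, h2, h3⟩ := hno y hy z hz
      refine h3 (hC.add_mem_of_isMax (hVC hy) (hVC hz) hq (hlt y hy) (hlt z hz) ?_ h1 h2)
      intro w' h1' h2'
      by_contra! h
      exact hyz w' h h1' h2')
    have := hmax _ (hhull w hwV)
    rw [map_add] at this
    linarith

/-! ### Hulls by translates -/

section Hull

variable {F : Type*} [AddCommGroup F]

/-- With `w = -u`, the points move while `C` stays fixed, the form used throughout. -/
lemma mem_translateHull {C A : Set F} {x : F} :
    x ∈ translateHull C A ↔ ∀ w, (∀ a ∈ A, a + w ∈ C) → x + w ∈ C := by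
  have key (u y : F) : y ∈ u +ᵥ C ↔ y + -u ∈ C := by
    rw [Set.mem_vadd_set_iff_neg_vadd_mem, vadd_eq_add, add_comm]
  simp only [translateHull, mem_iInter, Set.subset_def, key]
  exact ⟨fun h w hw => by simpa using h (-w) (by simpa using hw), fun h u hu => h (-u) hu⟩

lemma mem_spindle {C : Set F} {y z x : F} :
    x ∈ spindle C y z ↔ ∀ w, y + w ∈ C → z + w ∈ C → x + w ∈ C := by
  simp [spindle, mem_translateHull]

lemma subset_translateHull (C A : Set F) : A ⊆ translateHull C A :=
  fun _ ha => mem_translateHull.2 fun _ hw => hw _ ha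

lemma translateHull_mono (C : Set F) {A B : Set F} (h : A ⊆ B) :
    translateHull C A ⊆ translateHull C B :=
  fun _ hx => mem_translateHull.2 fun w hw => mem_translateHull.1 hx w fun a ha => hw a (h ha)

lemma translateHull_idem (C A : Set F) :
    translateHull C (translateHull C A) = translateHull C A := by
  refine subset_antisymm (fun x hx => mem_translateHull.2 fun w hw => ?_) (subset_translateHull _ _)
  exact mem_translateHull.1 hx w fun a ha => mem_translateHull.1 ha w hw

lemma structureHull_ballConvex_empty (C : Set F) :
    structureHull {K | IsBallConvex C K} ∅ = ∅ := by
  apply subset_eq_empty _ rfl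
  exact sInter_subset_of_mem ⟨Or.inl rfl, subset_rfl⟩

/-- Nonemptiness rules out the member `∅`; the translate hull is itself a member because it is
idempotent. -/
lemma structureHull_ballConvex (C : Set F) {A : Set F} (hA : A.Nonempty) :
    structureHull {K | IsBallConvex C K} A = translateHull C A := by
  apply subset_antisymm
  · exact sInter_subset_of_mem ⟨Or.inr (Or.inr (translateHull_idem C A).symm),
      subset_translateHull C A⟩
  · rintro x hx K ⟨hK | hK | hK, hAK⟩
    · rw [hK] at hAK
      exact absurd (hA.mono hAK) not_nonempty_empty
    · rw [hK]; trivial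
    · rw [hK]
      exact translateHull_mono C hAK hx

end Hull

lemma isClosed_translateHull {C : Set Plane} (hc : IsClosed C) (A : Set Plane) :
    IsClosed (translateHull C A) := by
  refine isClosed_iInter fun u => isClosed_iInter fun _ => ?_
  exact hc.vadd u

lemma Convex.translateHull {C : Set Plane} (hC : Convex ℝ C) (A : Set Plane) :
    Convex ℝ (translateHull C A) := by
  refine convex_iInter fun u => convex_iInter fun _ => hC.vadd u

/-! ### The upper bound three -/

/-- Each point of the ball hull of a closed set is in the ball hull of at most three points
of it. -/
lemma exists_three_points {C : Set Plane} (hC : IsConvexBody C) {V : Set Plane} (hV : IsClosed V)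
    (hne : V.Nonempty) {p : Plane} (hp : p ∈ translateHull C V) :
    ∃ W ⊆ V, W.Nonempty ∧ W.encard ≤ 3 ∧ p ∈ translateHull C W := by
  classical
  obtain ⟨hc, hconv, hi⟩ := hC
  obtain ⟨v₀, hv₀⟩ := hne
  by_cases hT : ∃ w₀, ∀ v ∈ V, v + w₀ ∈ C
  swap
  · have hno : ¬ (⋂ v : V, (fun w => (v : Plane) + w) ⁻¹' C).Nonempty := by
      rintro ⟨w, hw⟩
      exact hT ⟨w, fun v hv => by simpa using mem_iInter.1 hw ⟨v, hv⟩⟩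
    -- Helly for the sets of shifts taking a single point into `C`: some three or fewer points fit
    -- in no translate, so their hull is the whole plane.
    have := mt (Convex.helly_theorem_compact' (𝕜 := ℝ)
      (F := fun v : V => (fun w => (v : Plane) + w) ⁻¹' C)
      (fun v => hconv.translate_preimage_right _)
      (fun v => (Homeomorph.addLeft (v : Plane)).isClosedEmbedding.isCompact_preimage hc)) hno
    push Not at this
    obtain ⟨I, hI, hI0⟩ := this
    rw [finrank_euclideanSpace_fin] at hI
    have hIne : I.Nonempty := by
      rw [Finset.nonempty_iff_ne_empty]
      rintro rfl
      simp at hI0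
    refine ⟨Subtype.val '' (I : Set V), by rintro _ ⟨v, -, rfl⟩; exact v.2, ?_, ?_, ?_⟩
    · exact (Finset.coe_nonempty.2 hIne).image _
    · refine (encard_image_le _ _).trans ?_
      rw [encard_coe_eq_coe_finsetCard]
      exact_mod_cast hI
    · refine mem_translateHull.2 fun w hw => absurd hI0 (Nonempty.ne_empty ⟨w, ?_⟩)
      simp only [mem_iInter]
      exact fun v hv => hw _ ⟨v, hv, rfl⟩
  obtain ⟨w₀, hw₀⟩ := hT
  by_cases hpv : p = v₀
  · exact ⟨{v₀}, by simpa using hv₀, by simp, by simp, by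
      rw [hpv]; exact subset_translateHull _ _ rfl⟩
  have hVb : Bornology.IsBounded V :=
    ((Homeomorph.addRight w₀).isClosedEmbedding.isCompact_preimage hc).isBounded.subset hw₀
  have hVc : IsCompact V := Metric.isCompact_of_isClosed_isBounded hV hVb
  set H := translateHull C V with hH
  have hHcl : IsClosed H := isClosed_translateHull hc.isClosed V
  have hHb : Bornology.IsBounded H :=
    ((Homeomorph.addRight w₀).isClosedEmbedding.isCompact_preimage hc).isBounded.subset
      fun x hx => mem_translateHull.1 hx w₀ hw₀
  -- the last point `q` of the ray from `v₀` through `p` in the hull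
  set e := p - v₀ with he
  have he0 : e ≠ 0 := sub_ne_zero.2 hpv
  obtain ⟨s, hsH, hsmax⟩ : ∃ s, IsGreatest {s : ℝ | v₀ + s • e ∈ H} s := by
    exact ((Metric.isCompact_of_isClosed_isBounded hHcl hHb).line_preimage v₀ he0).exists_isGreatest ⟨1, by simpa [he] using hp⟩
  have hs1 : 1 ≤ s := hsmax (by simpa [he] using hp)
  set q := v₀ + s • e with hq
  set T : Set Plane := {w | ∀ v ∈ V, v + w ∈ C} with hT
  have hTc : IsCompact T := by
    have : T = ⋂ v ∈ V, (fun w => v + w) ⁻¹' C := by ext w; simp [hT]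
    refine ((Homeomorph.addLeft v₀).isClosedEmbedding.isCompact_preimage hc).of_isClosed_subset ?_
      fun w hw => hw v₀ hv₀
    rw [this]
    exact isClosed_iInter fun v => isClosed_iInter fun _ => hc.isClosed.preimage (by fun_prop)
  -- If `q` were interior to every translate containing `V`, compactness of `T` would let the ray
  -- stay in the hull beyond `q`.
  obtain ⟨w, hwT, hqw⟩ : ∃ w ∈ T, q + w ∉ interior C := by
    by_contra! hall
    have h1 : ∀ᶠ x in 𝓝 q, ∀ w ∈ T, x + w ∈ C := by
      refine hTc.eventually_forall_of_forall_eventually fun w hw => ?_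
      have : Tendsto (fun z : Plane × Plane => z.1 + z.2) (𝓝 (q, w)) (𝓝 (q + w)) :=
        continuous_add.tendsto (q, w)
      filter_upwards [this.eventually (isOpen_interior.mem_nhds (hall w hw))] with z hz
        using interior_subset hz
    have h2 : Tendsto (fun r : ℝ => v₀ + r • e) (𝓝[>] s) (𝓝 q) := by
      apply Tendsto.mono_left _ nhdsWithin_le_nhds
      have : Continuous fun r : ℝ => v₀ + r • e := by fun_prop
      exact this.tendsto s
    obtain ⟨r, hr, hrs⟩ := ((h2.eventually h1).and self_mem_nhdsWithin).exists
    have : r ≤ s := hsmax (mem_translateHull.2 hr)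
    exact not_lt.2 this hrs
  obtain ⟨n, hn⟩ := geometric_hahn_banach_open_point hconv.interior isOpen_interior hqw
  have hnC : ∀ x ∈ C, n x ≤ n (q + w) := by
    intro x hx
    have hx' : x ∈ closure (interior C) := by
      rw [hconv.closure_interior_eq_closure_of_nonempty_interior hi]; exact subset_closure hx
    exact closure_minimal (t := {x | n x ≤ n (q + w)}) (fun a ha => (hn a ha).le)
      (isClosed_le n.continuous continuous_const) hx'
  have hn0 : n ≠ 0 := by
    obtain ⟨c, hc⟩ := hi
    rintro rfl
    simpa using hn c hc
  obtain ⟨_, ⟨y, hy, rfl⟩, _, ⟨z, hz, rfl⟩, hyz⟩ := hconv.exists_pair_of_mem_hull hc hi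
    (V := (fun v => v + w) '' V) (hVc.image (by fun_prop))
    (by rintro _ ⟨v, hv, rfl⟩; exact hwT v hv) hn0 (mem_translateHull.1 hsH w hwT) hnC (by
      intro w' hw'
      rw [add_assoc]
      refine mem_translateHull.1 hsH _ fun v hv => ?_
      rw [← add_assoc]
      exact hw' _ ⟨v, hv, rfl⟩)
  refine ⟨{v₀, y, z}, ?_, by simp, encard_insert_le _ _ |>.trans ?_, mem_translateHull.2 ?_⟩
  · rintro x (rfl | rfl | rfl) <;> assumption
  · calc ({y, z} : Set Plane).encard + 1 ≤ (1 + 1) + 1 := by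
          gcongr; exact (encard_insert_le _ _).trans (by simp)
      _ = 3 := by norm_num
  · intro w' hw'
    have h0 : v₀ + w' ∈ C := hw' _ (by simp)
    have hqw' : q + w' ∈ C := by
      have := hyz (w' - w) (by convert hw' y (by simp) using 1; beta_reduce; abel)
        (by convert hw' z (by simp) using 1; beta_reduce; abel)
      convert this using 1; rw [hq]; abel
    have := hconv.add_smul_mem_of_le h0 (w := e) (r := s) (by
      convert hqw' using 1; rw [hq]; abel) zero_le_one hs1
    convert this using 1
    rw [he]; module

/-! ### Closed spindle convex sets are ball convex -/

/-- The support function of a compact set is Lipschitz. -/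
lemma exists_lipschitzWith_supportFunction {C : Set Plane} (hc : IsCompact C) (hne : C.Nonempty) :
    ∃ K, LipschitzWith K fun n : Plane => sSup ((fun z => inner ℝ n z) '' C) := by
  obtain ⟨R, hR⟩ := hc.isBounded.exists_norm_le
  refine ⟨R.toNNReal, LipschitzWith.of_le_add_mul _ fun n m => ?_⟩
  refine csSup_le (hne.image _) ?_
  rintro _ ⟨z, hz, rfl⟩
  have h1 : inner ℝ m z ≤ sSup ((fun z => inner ℝ m z) '' C) :=
    le_csSup (hc.bddAbove_image (by fun_prop)) ⟨z, hz, rfl⟩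
  have h2 : inner ℝ (n - m) z ≤ ‖n - m‖ * ‖z‖ := real_inner_le_norm _ _
  have h3 : ‖n - m‖ * ‖z‖ ≤ ‖n - m‖ * R := by gcongr; exact hR z hz
  rw [inner_sub_left] at h2
  have h4 : R ≤ R.toNNReal := Real.le_coe_toNNReal R
  rw [dist_eq_norm]
  nlinarith [norm_nonneg (n - m)]

/-- The directions in which a compact set has a unique extreme point are dense. -/
lemma exists_unique_maximizer {C : Set Plane} (hc : IsCompact C) (hne : C.Nonempty)
    {U : Set Plane} (hU : IsOpen U) (hUne : U.Nonempty) :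
    ∃ n ∈ U, ∃ t ∈ C, (∀ z ∈ C, inner ℝ n z ≤ inner ℝ n t) ∧
      ∀ x ∈ C, inner ℝ n t ≤ inner ℝ n x → x = t := by
  obtain ⟨K, hK⟩ := exists_lipschitzWith_supportFunction hc hne
  set h := fun n : Plane => sSup ((fun z => inner ℝ n z) '' C) with hh
  obtain ⟨n, hnU, hn⟩ := (MeasureTheory.Measure.dense_of_ae
    (hK.ae_differentiableAt (μ := MeasureTheory.volume))).inter_open_nonempty U hU hUne
  have hn : DifferentiableAt ℝ h n := hn
  obtain ⟨t, ht, htmax⟩ := hc.exists_isMaxOn hne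
    (f := fun z => inner ℝ n z) (by fun_prop)
  have htmax : ∀ z ∈ C, inner ℝ n z ≤ inner ℝ n t := fun z hz => htmax hz
  -- For a maximizer `x`, the function `h - ⟨x, ·⟩` is nonnegative and vanishes at `n`, so the
  -- gradient of `h` there is `x`; hence `x` is unique.
  have key : ∀ x ∈ C, inner ℝ n t ≤ inner ℝ n x → ∀ v, fderiv ℝ h n v = inner ℝ v x := by
    intro x hx hxt v
    have hmin : IsLocalMin (fun m => h m - innerSL ℝ x m) n := by
      refine Eventually.of_forall fun m => ?_
      have h1 : h n ≤ inner ℝ n t := csSup_le (hne.image _) (by rintro _ ⟨z, hz, rfl⟩; exact htmax z hz)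
      have h2 : inner ℝ m x ≤ h m := le_csSup (hc.bddAbove_image (by fun_prop)) ⟨x, hx, rfl⟩
      simp only [innerSL_apply_apply]
      rw [real_inner_comm x m, real_inner_comm x n] at *
      linarith
    have h0 := hmin.fderiv_eq_zero
    rw [fderiv_fun_sub hn (innerSL ℝ x).differentiableAt, ContinuousLinearMap.fderiv,
      sub_eq_zero] at h0
    rw [h0, innerSL_apply_apply, real_inner_comm]
  refine ⟨n, hnU, t, ht, htmax, fun x hx hxt => ?_⟩
  refine ext_inner_left ℝ fun v => ?_
  rw [← key x hx hxt, ← key t ht le_rfl]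

/-- Closed spindle convex sets are intersections of translates. -/
lemma IsSpindleConvex.eq_translateHull {C : Set Plane} (hC : IsConvexBody C) {K : Set Plane}
    (hK : IsClosed K) (hs : IsSpindleConvex C K) (hne : K.Nonempty) (huniv : K ≠ univ) :
    K = translateHull C K := by
  obtain ⟨hc, hconv, hi⟩ := hC
  have hCne : C.Nonempty := hi.mono interior_subset
  have hsp : ∀ y ∈ K, ∀ z ∈ K, ∀ x, (∀ w, y + w ∈ C → z + w ∈ C → x + w ∈ C) → x ∈ K :=
    fun y hy z hz x hx => hs y hy z hz (mem_spindle.2 hx)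
  have hpair : ∀ y ∈ K, ∀ z ∈ K, ∃ w, y + w ∈ C ∧ z + w ∈ C := by
    intro y hy z hz
    by_contra! h
    exact huniv (eq_univ_of_forall fun x => hsp y hy z hz x fun w h1 h2 => absurd h2 (h w h1))
  have hKb : Bornology.IsBounded K := by
    obtain ⟨y, hy⟩ := hne
    refine (hc.isBounded.sub hc.isBounded |>.add (Bornology.isBounded_singleton (x := y))).subset ?_
    intro z hz
    obtain ⟨w, h1, h2⟩ := hpair y hy z hz
    exact ⟨_, ⟨_, h2, _, h1, rfl⟩, y, rfl, by simp⟩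
  have hKc : IsCompact K := Metric.isCompact_of_isClosed_isBounded hK hKb
  have hKconv : Convex ℝ K := by
    rw [convex_iff_segment_subset]
    intro y hy z hz x hx
    refine hsp y hy z hz x fun w h1 h2 => ?_
    have := (hconv.translate_preimage_left w).segment_subset (x := y) (y := z) h1 h2 hx
    exact this
  refine subset_antisymm (subset_translateHull C K) fun p hp => ?_
  by_contra hpK
  obtain ⟨f, r, hf1, hf2⟩ := geometric_hahn_banach_closed_point hKconv hK hpK
  obtain ⟨n, hn, t, ht, htmax, htu⟩ := exists_unique_maximizer hc hCne
    (U := interior {n : Plane | ∀ x ∈ K, inner ℝ n x < inner ℝ n p}) isOpen_interior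
    ⟨(InnerProductSpace.toDual ℝ Plane).symm f, by
      rw [mem_interior_iff_mem_nhds]
      refine hKc.eventually_forall_of_forall_eventually fun x hx => ?_
      have h1 : Continuous fun z : Plane × Plane => (inner ℝ z.1 z.2 : ℝ) := by fun_prop
      have h2 : Continuous fun z : Plane × Plane => (inner ℝ z.1 p : ℝ) := by fun_prop
      refine (isOpen_lt h1 h2).mem_nhds ?_
      simp only [mem_ofPred_eq, InnerProductSpace.toDual_symm_apply]
      exact (hf1 x hx).trans hf2⟩
  have hn := interior_subset hn
  obtain ⟨x, hx, hxmax⟩ := hKc.exists_isMaxOn hne (f := fun z => inner ℝ n z) (by fun_prop)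
  have hxmax : ∀ z ∈ K, inner ℝ n z ≤ inner ℝ n x := fun z hz => hxmax hz
  -- the translate touching `K` at `x` with top point `t` contains `K`
  have hall : ∀ y ∈ K, y + (t - x) ∈ C := by
    intro y hy
    have hcomp : IsCompact {w | x + w ∈ C ∧ y + w ∈ C} :=
      ((Homeomorph.addLeft x).isClosedEmbedding.isCompact_preimage hc).inter_right
        (hc.isClosed.preimage (f := fun w => y + w) (by fun_prop))
    -- Raise `x` and `y` together as far as `C` allows. If `x + w` stayed below `t`, then `t - w`
    -- would be in their spindle, hence in `K`, yet higher than `x`. So `x + w = t`.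
    obtain ⟨w, ⟨hxw, hyw⟩, hmin⟩ := hcomp.exists_isMaxOn (hpair x hx y hy)
      (f := fun w => inner ℝ n w) (by fun_prop)
    have hmin : ∀ w', x + w' ∈ C → y + w' ∈ C → inner ℝ n w' ≤ inner ℝ n w :=
      fun w' h1 h2 => hmin ⟨h1, h2⟩
    have htop : (inner ℝ n t : ℝ) ≤ inner ℝ n (x + w) := by
      by_contra! hlt
      have hle : (inner ℝ n (y + w) : ℝ) ≤ inner ℝ n (x + w) := by
        simpa only [inner_add_right, add_le_add_iff_right] using hxmax y hy
      have htK : t - w ∈ K := by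
        refine hsp x hx y hy _ fun w' h1 h2 => ?_
        have := hconv.add_mem_of_isMax (n := innerSL ℝ n) hxw hyw ht (by simpa using hlt)
          (by simpa using hle.trans_lt hlt) (w := w' - w) (by
            intro w'' h1 h2
            have := hmin (w + w'') (by rwa [← add_assoc]) (by rwa [← add_assoc])
            rw [inner_add_right] at this
            simp only [innerSL_apply_apply]; linarith)
          (by convert h1 using 1; abel) (by convert h2 using 1; abel)
        convert this using 1; abel
      have := hxmax _ htK
      rw [inner_sub_right] at this
      rw [inner_add_right] at hlt
      linarith
    have : x + w = t := htu _ hxw htop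
    rwa [← this, add_sub_cancel_left]
  have hpt := htmax _ (mem_translateHull.1 hp _ hall)
  have hpx := hn x hx
  simp only [inner_add_right, inner_sub_right] at hpt
  linarith

/-- In the plane, the closed spindle convex sets are the ball convex sets. -/
lemma isClosed_and_isSpindleConvex_iff {C : Set Plane} (hC : IsConvexBody C) {K : Set Plane} :
    IsClosed K ∧ IsSpindleConvex C K ↔ IsBallConvex C K := by
  constructor
  · rintro ⟨hK, hs⟩
    rcases K.eq_empty_or_nonempty with h | hne
    · exact Or.inl h
    by_cases h : K = univ
    · exact Or.inr (Or.inl h)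
    · exact Or.inr (Or.inr (hs.eq_translateHull hC hK hne h))
  · rintro (rfl | rfl | h)
    · exact ⟨isClosed_empty, fun p hp => hp.elim⟩
    · exact ⟨isClosed_univ, fun _ _ _ _ => subset_univ _⟩
    · rw [h]
      refine ⟨isClosed_translateHull hC.1.isClosed K, fun p hp q hq => ?_⟩
      rw [← translateHull_idem C K]
      exact translateHull_mono C (by rintro x (rfl | rfl) <;> assumption)

lemma spindleCaratheodoryNumber_eq {C : Set Plane} (hC : IsConvexBody C) :
    spindleCaratheodoryNumber C = ballCaratheodoryNumber C := by
  unfold spindleCaratheodoryNumber ballCaratheodoryNumber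
  simp only [isClosed_and_isSpindleConvex_iff hC]

/-! ### The value two for parallelograms -/

/-- A criterion for the value of the ball Carathéodory number. -/
lemma ballCaratheodoryNumber_eq {C : Set Plane} {k : ℕ} (hk : 0 < k)
    (hle : ∀ V : Set Plane, IsClosed V → V.Nonempty → ∀ p ∈ translateHull C V,
      ∃ W ⊆ V, W.Nonempty ∧ W.encard ≤ k ∧ p ∈ translateHull C W)
    {V : Set Plane} {p : Plane} (hV : IsClosed V) (hne : V.Nonempty) (hp : p ∈ translateHull C V)
    (hlt : ∀ W ⊆ V, W.Nonempty → W.encard < k → p ∉ translateHull C W) :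
    ballCaratheodoryNumber C = k := by
  apply le_antisymm
  · refine sInf_le ⟨k, ⟨hk, fun V hV p hp => ?_⟩, rfl⟩
    rcases V.eq_empty_or_nonempty with rfl | hne
    · rw [structureHull_ballConvex_empty] at hp
      exact hp.elim
    · rw [structureHull_ballConvex C hne] at hp
      obtain ⟨W, hWV, hW, hcard, hpW⟩ := hle V hV hne p hp
      exact ⟨W, hWV, hcard, by rwa [structureHull_ballConvex C hW]⟩
  · refine le_sInf ?_
    rintro _ ⟨j, ⟨-, hj⟩, rfl⟩
    by_contra! hjk
    obtain ⟨W, hWV, hcard, hpW⟩ := hj V hV p (by rwa [structureHull_ballConvex C hne])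
    rcases W.eq_empty_or_nonempty with rfl | hW
    · rw [structureHull_ballConvex_empty] at hpW
      exact hpW
    · rw [structureHull_ballConvex C hW] at hpW
      exact hlt W hWV hW (hcard.trans_lt hjk) hpW

/-- Place `x` at a farthest point of `C` in the direction `p - x`; then `p ≠ x` would fall outside.
-/
lemma eq_of_mem_translateHull_singleton {C : Set Plane} (hc : IsCompact C) (hne : C.Nonempty)
    {p x : Plane} (h : p ∈ translateHull C {x}) : p = x := by
  obtain ⟨c, hcC, hmax⟩ := hc.exists_isMaxOn hne (f := fun z => inner ℝ (p - x) z) (by fun_prop)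
  have h1 : p + (c - x) ∈ C := mem_translateHull.1 h _ (by simpa using hcC)
  have h2 : (inner ℝ (p - x) (p + (c - x)) : ℝ) ≤ inner ℝ (p - x) c := hmax h1
  rw [show p + (c - x) = c + (p - x) by abel, inner_add_right] at h2
  have h3 : (inner ℝ (p - x) (p - x) : ℝ) ≤ 0 := by linarith
  rw [real_inner_self_eq_norm_sq] at h3
  exact sub_eq_zero.1 (norm_eq_zero.1 (by nlinarith [norm_nonneg (p - x)]))

/-- A parallelogram is a box with respect to the coordinates of some basis. -/
lemma IsParallelogram.exists_basis {C : Set Plane} (hC : IsParallelogram C) :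
    ∃ (b : Module.Basis (Fin 2) ℝ Plane) (a : Plane),
      ∀ x, x ∈ C ↔ ∀ i, b.repr a i ≤ b.repr x i ∧ b.repr x i ≤ b.repr a i + 1 := by
  obtain ⟨a, u, v, hli, rfl⟩ := hC
  set b := basisOfLinearIndependentOfCardEqFinrank hli (by simp) with hb
  refine ⟨b, a, fun x => ?_⟩
  have : (b : Fin 2 → Plane) = ![u, v] := by simp [hb]
  rw [Set.mem_vadd_set_iff_neg_vadd_mem, ← this, parallelepiped_basis_eq]
  simp only [mem_ofPred_eq, vadd_eq_add, map_add, map_neg, Finsupp.add_apply, Finsupp.neg_apply,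
    mem_Icc]
  refine forall_congr' fun i => ?_
  constructor <;> rintro ⟨h1, h2⟩ <;> constructor <;> linarith

/-- In the ball hull of a closed set with respect to a parallelogram, each point is in the ball
hull of two points. -/
lemma IsParallelogram.exists_two_points {C : Set Plane} (hC : IsParallelogram C) {V : Set Plane}
    (hV : IsClosed V) (hne : V.Nonempty) {p : Plane} (hp : p ∈ translateHull C V) :
    ∃ W ⊆ V, W.Nonempty ∧ W.encard ≤ 2 ∧ p ∈ translateHull C W := by
  obtain ⟨b, a, hb⟩ := hC.exists_basis
  suffices h : ∃ y ∈ V, ∃ z ∈ V, p ∈ translateHull C {y, z} by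
    obtain ⟨y, hy, z, hz, h⟩ := h
    refine ⟨{y, z}, ?_, by simp, ?_, h⟩
    · rintro x (rfl | rfl) <;> assumption
    · exact (encard_insert_le _ _).trans (by simp [one_add_one_eq_two])
  -- Two points more than one apart in a coordinate lie in no common translate, so their hull is the
  -- plane.
  by_cases hbig : ∃ i, ∃ y ∈ V, ∃ z ∈ V, b.repr y i + 1 < b.repr z i
  · obtain ⟨i, y, hy, z, hz, h⟩ := hbig
    refine ⟨y, hy, z, hz, mem_translateHull.2 fun w hw => ?_⟩
    have h1 := (hb _).1 (hw y (by simp)) i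
    have h2 := (hb _).1 (hw z (by simp)) i
    simp only [map_add, Finsupp.add_apply] at h1 h2
    linarith
  push Not at hbig
  obtain ⟨y₀, hy₀⟩ := hne
  have hVc : IsCompact V := by
    have hK : IsCompact ((fun t : Fin 2 → ℝ => y₀ + ∑ i, t i • b i) '' Icc (-1) 1) :=
      isCompact_Icc.image (by fun_prop)
    refine hK.of_isClosed_subset hV fun z hz => ⟨fun i => b.repr (z - y₀) i, ⟨fun i => ?_, fun i => ?_⟩, ?_⟩
    · have := hbig i z hz y₀ hy₀
      simp only [map_sub, Finsupp.sub_apply, Pi.neg_apply, Pi.one_apply]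
      linarith
    · have := hbig i y₀ hy₀ z hz
      simp only [map_sub, Finsupp.sub_apply, Pi.one_apply]
      linarith
    · simp only [b.sum_repr]; abel
  have hcont (i : Fin 2) : Continuous fun x => b.repr x i :=
    (b.coord i).continuous_of_finiteDimensional
  choose lo hloV hlo using fun i : Fin 2 => hVc.exists_isMinOn ⟨y₀, hy₀⟩ (hcont i).continuousOn
  choose hi hhiV hhi using fun i : Fin 2 => hVc.exists_isMaxOn ⟨y₀, hy₀⟩ (hcont i).continuousOn
  have hlo : ∀ i, ∀ v ∈ V, b.repr (lo i) i ≤ b.repr v i := fun i v hv => hlo i hv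
  have hhi : ∀ i, ∀ v ∈ V, b.repr v i ≤ b.repr (hi i) i := fun i v hv => hhi i hv
  have hcoord (t : Fin 2 → ℝ) : ∃ w, ∀ i, b.repr w i = t i :=
    ⟨b.equivFun.symm t, fun i => by
      rw [← b.equivFun_apply, LinearEquiv.apply_symm_apply]⟩
  have hplo : ∀ i, b.repr (lo i) i ≤ b.repr p i := by
    -- This shift aligns the lower corner of the box of `V` with that of `C`.
    obtain ⟨w, hw⟩ := hcoord fun i => b.repr a i - b.repr (lo i) i
    have := (hb _).1 (mem_translateHull.1 hp w fun v hv => (hb _).2 fun i => by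
      simp only [map_add, Finsupp.add_apply, hw]
      have h1 := hlo i v hv
      have h2 := hbig i _ (hloV i) v hv
      constructor <;> linarith)
    intro i
    have := (this i).1
    simp only [map_add, Finsupp.add_apply, hw] at this
    linarith
  have hphi : ∀ i, b.repr p i ≤ b.repr (hi i) i := by
    obtain ⟨w, hw⟩ := hcoord fun i => b.repr a i + 1 - b.repr (hi i) i
    have := (hb _).1 (mem_translateHull.1 hp w fun v hv => (hb _).2 fun i => by
      simp only [map_add, Finsupp.add_apply, hw]
      have h1 := hhi i v hv
      have h2 := hbig i v hv _ (hhiV i)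
      constructor <;> linarith)
    intro i
    have := (this i).2
    simp only [map_add, Finsupp.add_apply, hw] at this
    linarith
  have hbox : ∀ y z, (∀ i, b.repr y i ≤ b.repr p i ∧ b.repr p i ≤ b.repr z i ∨
      b.repr z i ≤ b.repr p i ∧ b.repr p i ≤ b.repr y i) → p ∈ translateHull C {y, z} := by
    intro y z h
    refine mem_translateHull.2 fun w hw => (hb _).2 fun i => ?_
    have h1 := (hb _).1 (hw y (by simp)) i
    have h2 := (hb _).1 (hw z (by simp)) i
    simp only [map_add, Finsupp.add_apply] at h1 h2 ⊢
    rcases h i with h | h <;> constructor <;> linarith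
  have hopp : ∀ y ∈ V, ∀ z ∈ V, (∀ i, b.repr y i ≤ b.repr p i ∧ b.repr p i ≤ b.repr z i ∨
      b.repr z i ≤ b.repr p i ∧ b.repr p i ≤ b.repr y i) →
      ∃ y ∈ V, ∃ z ∈ V, p ∈ translateHull C {y, z} :=
    fun y hy z hz h => ⟨y, hy, z, hz, hbox y z h⟩
  simp only [Fin.forall_fin_two] at hopp
  have A := hphi 0
  have B := hplo 0
  have D := hphi 1
  have E := hplo 1
  have hAB := hopp _ (hhiV 0) _ (hloV 0)
  have hAD := hopp _ (hhiV 0) _ (hhiV 1)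
  have hAE := hopp _ (hhiV 0) _ (hloV 1)
  have hBD := hopp _ (hloV 0) _ (hhiV 1)
  have hBE := hopp _ (hloV 0) _ (hloV 1)
  -- The two extreme points in coordinate `0` work if coordinate `1` of `p` is between theirs.
  -- Otherwise take the extreme point in coordinate `1` on the other side of `p`, paired with one of
  -- them.
  rcases le_total (b.repr (hi 0) 1) (b.repr p 1) with a1 | a1 <;>
  rcases le_total (b.repr (lo 0) 1) (b.repr p 1) with b1 | b1
  · rcases le_total (b.repr (hi 1) 0) (b.repr p 0) with d1 | d1
    · exact hAD ⟨Or.inr ⟨d1, A⟩, Or.inl ⟨a1, D⟩⟩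
    · exact hBD ⟨Or.inl ⟨B, d1⟩, Or.inl ⟨b1, D⟩⟩
  · exact hAB ⟨Or.inr ⟨B, A⟩, Or.inl ⟨a1, b1⟩⟩
  · exact hAB ⟨Or.inr ⟨B, A⟩, Or.inr ⟨b1, a1⟩⟩
  · rcases le_total (b.repr (lo 1) 0) (b.repr p 0) with e1 | e1
    · exact hAE ⟨Or.inr ⟨e1, A⟩, Or.inr ⟨E, a1⟩⟩
    · exact hBE ⟨Or.inl ⟨B, e1⟩, Or.inr ⟨E, b1⟩⟩

/-- The ball Carathéodory number of a parallelogram is two. -/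
lemma IsParallelogram.ballCaratheodoryNumber_eq_two {C : Set Plane} (hC : IsConvexBody C)
    (hP : IsParallelogram C) : ballCaratheodoryNumber C = 2 := by
  have hCne : C.Nonempty := hC.2.2.mono interior_subset
  set y : Plane := EuclideanSpace.single 0 2
  have hy : y ≠ 0 := by simp [y]
  have hmid : (1 / 2 : ℝ) • y ∈ translateHull C {0, y} := by
    refine (hC.2.1.translateHull _).segment_subset (subset_translateHull C _ (show (0 : Plane) ∈ {0, y} by simp))
      (subset_translateHull C _ (show y ∈ {0, y} by simp)) ?_
    exact ⟨1 / 2, 1 / 2, by norm_num, by norm_num, by norm_num, by simp⟩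
  refine ballCaratheodoryNumber_eq (k := 2) two_pos
    (fun V hV hne p hp => hP.exists_two_points hV hne hp) (V := {0, y})
    (toFinite _).isClosed (by simp) hmid ?_
  intro W hW hne hcard hmem
  have hle : W.encard ≤ 1 := by
    have : W.encard < 1 + 1 := by rw [one_add_one_eq_two]; exact hcard
    exact Order.lt_add_one_iff_of_not_isMax (by simp) |>.1 this
  obtain ⟨x, rfl⟩ := encard_eq_one.1 (le_antisymm hle (one_le_encard_iff_nonempty.2 hne))
  have h := eq_of_mem_translateHull_singleton hC.1 hCne hmem
  rcases hW rfl with hx | hx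
  · rw [hx, smul_eq_zero] at h
    simp [hy] at h
  · rw [mem_singleton_iff.1 hx] at h
    have : (1 / 2 : ℝ) • y = 0 := by
      have h2 : (1 / 2 : ℝ) • y = y - (1 / 2 : ℝ) • y := by module
      rw [h2, h, sub_self]
    simp [hy] at this

/-! ### Normals at smooth boundary points -/

/-- `n` is an outer normal of `C` at a smooth boundary point. -/
def IsRegularNormal (C : Set Plane) (n : Plane →L[ℝ] ℝ) : Prop :=
  n ≠ 0 ∧ ∃ x ∈ C, (∀ y ∈ C, n y ≤ n x) ∧ ∀ d, n d < 0 → ∃ ε : ℝ, 0 < ε ∧ x + ε • d ∈ interior C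

lemma IsRegularNormal.smul {C : Set Plane} {n : Plane →L[ℝ] ℝ} (hn : IsRegularNormal C n) {r : ℝ}
    (hr : 0 < r) : IsRegularNormal C (r • n) := by
  obtain ⟨h0, x, hx, hmax, hreg⟩ := hn
  refine ⟨smul_ne_zero hr.ne' h0, x, hx, fun y hy => ?_, fun d hd => hreg d ?_⟩
  · simpa using mul_le_mul_of_nonneg_left (hmax y hy) hr.le
  · by_contra! h
    have := mul_nonneg hr.le h
    simp only [smul_apply, smul_eq_mul] at hd
    linarith

/-- The gauge `g` is Lipschitz, so it is differentiable at some `p ∈ O`; take `n` to be its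
derivative. Homogeneity gives `n p = g p > 1` and subadditivity `n ≤ g`, so `n` supports `C` at `p /
g p`. Directions with `n d < 0` decrease `g`, so they enter the interior. -/
lemma Convex.exists_regularNormal_of_zero_mem {C : Set Plane} (hC : Convex ℝ C)
    (hcl : IsClosed C) (h0 : (0 : Plane) ∈ interior C) {O : Set Plane} (hO : IsOpen O)
    (hne : O.Nonempty) (hdisj : Disjoint O C) :
    ∃ p ∈ O, ∃ n, IsRegularNormal C n ∧ ∀ y ∈ C, n y < n p := by
  have hnhds : C ∈ 𝓝 (0 : Plane) := mem_interior_iff_mem_nhds.1 h0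
  have habs : Absorbent ℝ C := absorbent_nhds_zero hnhds
  obtain ⟨K, hK⟩ := hC.lipschitz_gauge hnhds
  set g := gauge C with hg
  obtain ⟨p, hpO, hp⟩ := (MeasureTheory.Measure.dense_of_ae
    (hK.ae_differentiableAt (μ := MeasureTheory.volume))).inter_open_nonempty O hO hne
  have hp : DifferentiableAt ℝ g p := hp
  have hmem (x : Plane) : g x ≤ 1 ↔ x ∈ C := by
    rw [hg, gauge_le_one_iff_mem_closure hC hnhds, hcl.closure_eq]
  have hgp : 1 < g p := by
    by_contra! h
    exact disjoint_left.1 hdisj hpO ((hmem p).1 h)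
  have hgp0 : 0 < g p := zero_lt_one.trans hgp
  set n := fderiv ℝ g p with hn
  have hline (v : Plane) : HasDerivAt (fun t : ℝ => g (p + t • v)) (n v) 0 :=
    hp.hasFDerivAt.hasLineDerivAt v
  have hnp : n p = g p := by
    have h1 : HasDerivAt (fun t : ℝ => (1 + t) * g p) (g p) 0 := by
      simpa using ((hasDerivAt_id (0 : ℝ)).const_add 1).mul_const (g p)
    refine (hline p).unique (h1.congr_of_eventuallyEq ?_)
    filter_upwards [lt_mem_nhds (show (-1 : ℝ) < 0 by norm_num)] with t ht
    have : p + t • p = (1 + t) • p := by module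
    rw [this, hg, gauge_smul_of_nonneg (by linarith), smul_eq_mul]
  have hle (v : Plane) : n v ≤ g v := by
    refine le_of_tendsto (hline v).tendsto_slope_zero_right ?_
    filter_upwards [self_mem_nhdsWithin] with t ht
    have ht : 0 < t := ht
    have h1 : g (p + t • v) ≤ g p + g (t • v) := gauge_add_le hC habs _ _
    rw [hg, gauge_smul_of_nonneg ht.le, smul_eq_mul, ← hg] at h1
    simp only [zero_add, zero_smul, add_zero, smul_eq_mul]
    rw [inv_mul_le_iff₀ ht]
    linarith
  have hnx : n ((g p)⁻¹ • p) = 1 := by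
    rw [map_smul, hnp, smul_eq_mul, inv_mul_cancel₀ hgp0.ne']
  refine ⟨p, hpO, n, ⟨?_, (g p)⁻¹ • p, ?_, fun y hy => ?_, fun d hd => ?_⟩, fun y hy => ?_⟩
  · intro h
    rw [h] at hnx
    simp at hnx
  · rw [← hmem, hg, gauge_smul_of_nonneg (by positivity), ← hg, smul_eq_mul,
      inv_mul_cancel₀ hgp0.ne']
  · rw [hnx]
    exact (hle y).trans ((hmem y).2 hy)
  · have hev := (hline d).tendsto_slope_zero_right.eventually (gt_mem_nhds hd)
    obtain ⟨t, ht, ht0⟩ := (hev.and self_mem_nhdsWithin).exists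
    have ht0 : 0 < t := ht0
    simp only [zero_add, zero_smul, add_zero, smul_eq_mul] at ht
    have hlt : g (p + t • d) < g p := by
      by_contra! h
      have : 0 ≤ t⁻¹ * (g (p + t • d) - g p) := mul_nonneg (by positivity) (by linarith)
      linarith
    refine ⟨(g p)⁻¹ * t, by positivity, ?_⟩
    rw [← gauge_lt_one_iff_mem_interior hC hnhds]
    have : (g p)⁻¹ • p + ((g p)⁻¹ * t) • d = (g p)⁻¹ • (p + t • d) := by module
    rw [this, gauge_smul_of_nonneg (by positivity), ← hg, smul_eq_mul, inv_mul_lt_iff₀ hgp0,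
      mul_one]
    exact hlt
  · rw [hnp]
    exact ((hle y).trans ((hmem y).2 hy)).trans_lt hgp

/-- An open set disjoint from a convex body `C` contains a point separated from `C` by a normal at
a smooth boundary point. -/
lemma IsConvexBody.exists_regularNormal {C : Set Plane} (hC : IsConvexBody C) {O : Set Plane}
    (hO : IsOpen O) (hne : O.Nonempty) (hdisj : Disjoint O C) :
    ∃ p ∈ O, ∃ n, IsRegularNormal C n ∧ ∀ y ∈ C, n y < n p := by
  obtain ⟨hc, hconv, c, hcint⟩ := hC
  have hint (x : Plane) : x ∈ interior ((fun z => z + c) ⁻¹' C) ↔ x + c ∈ interior C := by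
    exact iff_of_eq (congrArg (x ∈ ·) ((Homeomorph.addRight c).preimage_interior C).symm)
  obtain ⟨p, hp, n, ⟨hn0, x, hx, hmax, hreg⟩, hsep⟩ :=
    (hconv.translate_preimage_left c).exists_regularNormal_of_zero_mem
      (hc.isClosed.preimage (by fun_prop)) ((hint 0).2 (by simpa using hcint))
      (O := (fun z => z + c) ⁻¹' O) (hO.preimage (by fun_prop))
      (by obtain ⟨o, ho⟩ := hne; exact ⟨o - c, by simpa using ho⟩) (hdisj.preimage _)
  refine ⟨p + c, hp, n, ⟨hn0, x + c, hx, fun y hy => ?_, fun d hd => ?_⟩, fun y hy => ?_⟩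
  · have := hmax (y - c) (by simpa using hy)
    rw [map_sub] at this
    rw [map_add]; linarith
  · obtain ⟨ε, hε, h⟩ := hreg d hd
    refine ⟨ε, hε, ?_⟩
    rw [hint] at h
    convert h using 1; abel
  · have := hsep (y - c) (by simpa using hy)
    rw [map_sub] at this
    rw [map_add]; linarith

/-- The normals at smooth boundary points span the dual plane positively. -/
lemma IsConvexBody.exists_regularNormal_pos {C : Set Plane} (hC : IsConvexBody C) {d : Plane}
    (hd : d ≠ 0) : ∃ n, IsRegularNormal C n ∧ 0 < n d := by
  obtain ⟨c, hc⟩ := hC.2.2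
  obtain ⟨M, hM⟩ := (hC.1.line_preimage c hd).bddAbove
  set R := max M 0 + 1 with hR
  have hR0 : 0 < R := by positivity
  -- `R` exceeds every parameter at which the line meets `C`, so part of the interior shifted by `R
  -- • d` is outside `C`. Separating `p` there from `C`, which contains `p - R • d`, forces `n d >
  -- 0`.
  obtain ⟨p, ⟨hp, -⟩, n, hn, hsep⟩ := hC.exists_regularNormal
    (O := (fun x => x - R • d) ⁻¹' interior C ∩ Cᶜ)
    ((isOpen_interior.preimage (by fun_prop)).inter hC.1.isClosed.isOpen_compl)
    ⟨c + R • d, by simpa using hc, fun h => by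
      have : R ≤ M := hM h
      have := le_max_left M 0
      linarith⟩ (disjoint_compl_left.mono_left inter_subset_right)
  refine ⟨n, hn, ?_⟩
  have := hsep _ (interior_subset hp)
  rw [map_sub, map_smul, smul_eq_mul] at this
  by_contra! h
  nlinarith

/-! ### Positively spanning cones of functionals -/

namespace Plane

lemma eq_smul_add_smul {m : Plane →L[ℝ] ℝ} {e d : Plane} (he : m e = 1) (hd : d ≠ 0) (hmd : m d = 0)
    (x : Plane) : ∃ r : ℝ, x = m x • e + r • d := by
  have hm : m ≠ 0 := by rintro rfl; simp at he
  obtain ⟨r, hr⟩ := exists_eq_smul_of_apply_eq_zero hm hd hmd (w := x - m x • e) (by simp [he])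
  exact ⟨r, by rw [← hr]; abel⟩

lemma functional_eq_smul {m n : Plane →L[ℝ] ℝ} {e d : Plane} (he : m e = 1) (hd : d ≠ 0)
    (hmd : m d = 0) (hnd : n d = 0) : n = n e • m := by
  ext x
  obtain ⟨r, hr⟩ := eq_smul_add_smul he hd hmd x
  conv_lhs => rw [hr]
  simp [hnd, mul_comm]

/-- Let `N` be a positively spanning cone of non-zero functionals on the plane, in which no three
functionals, not all parallel, add up to zero. Then `N` is symmetric. -/
lemma neg_mem_of_no_triple {N : Set (Plane →L[ℝ] ℝ)} (h0 : ∀ n ∈ N, n ≠ 0)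
    (hsmul : ∀ n ∈ N, ∀ r : ℝ, 0 < r → r • n ∈ N) (hspan : ∀ d : Plane, d ≠ 0 → ∃ n ∈ N, 0 < n d)
    (hno : ∀ n₁ ∈ N, ∀ n₂ ∈ N, -(n₁ + n₂) ∈ N → ∀ d, n₁ d = 0 → n₂ d = 0) {m : Plane →L[ℝ] ℝ}
    (hm : m ∈ N) : -m ∈ N := by
  by_contra hneg
  obtain ⟨d, hd, hmd⟩ := exists_ne_zero_apply_eq_zero m
  obtain ⟨e, he⟩ := exists_apply_eq_one (h0 m hm)
  -- Otherwise a positive combination of `n` and `n'` equals `-c • m` with `c > 0`, giving a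
  -- forbidden triple.
  have hcmp : ∀ n ∈ N, 0 < n d → ∀ n' ∈ N, n' d < 0 → n' e / n' d ≤ n e / n d := by
    intro n hn hnd n' hn' hnd'
    by_contra! hlt
    set c := n' e / n' d - n e / n d with hc
    have hc0 : 0 < c := sub_pos.2 hlt
    have hsum : -(c • m + (n d)⁻¹ • n) = (-n' d)⁻¹ • n' := by
      have hnd0 := hnd.ne'
      have hnd0' := hnd'.ne
      have := functional_eq_smul he hd hmd (n := (n d)⁻¹ • n + (-n' d)⁻¹ • n')
        (by simp; field_simp; ring)
      have hce : ((n d)⁻¹ • n + (-n' d)⁻¹ • n') e = -c := by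
        simp [hc]; field_simp; ring
      rw [hce] at this
      ext x
      have hx := congrArg (fun f : Plane →L[ℝ] ℝ => f x) this
      simp only [add_apply, smul_apply, neg_apply, smul_eq_mul] at hx ⊢
      linarith
    have := hno (c • m) (hsmul m hm c hc0) ((n d)⁻¹ • n) (hsmul n hn _ (by positivity))
      (by rw [hsum]; exact hsmul n' hn' _ (inv_pos.2 (by linarith))) d (by simp [hmd])
    simp [hnd.ne'] at this
  set S := (fun n : Plane →L[ℝ] ℝ => n e / n d) '' {n | n ∈ N ∧ n d < 0} with hS
  obtain ⟨n₁, hn₁, hn₁d⟩ := hspan d hd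
  obtain ⟨n₂, hn₂, hn₂d⟩ := hspan (-d) (neg_ne_zero.2 hd)
  rw [map_neg, neg_pos] at hn₂d
  have hSne : S.Nonempty := ⟨_, n₂, ⟨hn₂, hn₂d⟩, rfl⟩
  have hSb : BddAbove S := ⟨n₁ e / n₁ d, by
    rintro _ ⟨n', ⟨hn', hd'⟩, rfl⟩; exact hcmp n₁ hn₁ hn₁d n' hn' hd'⟩
  -- `sSup S` separates the two sets of slopes, so no member with `n d ≠ 0` is positive at this
  -- vector; one with `n d = 0` would be a negative multiple of `m`.
  obtain ⟨n, hn, hpos⟩ := hspan (-e + sSup S • d) (by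
    intro h
    have := congrArg m h
    simp [he, hmd] at this)
  simp only [map_add, map_neg, map_smul, smul_eq_mul] at hpos
  rcases lt_trichotomy (n d) 0 with hnd | hnd | hnd
  · have : n e / n d ≤ sSup S := le_csSup hSb ⟨n, ⟨hn, hnd⟩, rfl⟩
    rw [div_le_iff_of_neg hnd] at this
    linarith
  · have hne := functional_eq_smul he hd hmd hnd
    rw [hnd] at hpos
    apply hneg
    have hne0 : n e < 0 := by linarith
    generalize n e = r at hne hne0
    have : -m = (-r)⁻¹ • n := by
      ext x
      have hx := congrArg (fun f : Plane →L[ℝ] ℝ => f x) hne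
      simp only [smul_apply, neg_apply, smul_eq_mul] at hx ⊢
      have := hne0.ne
      rw [hx]; field_simp
    rw [this]
    exact hsmul n hn _ (inv_pos.2 (by linarith))
  · have : sSup S ≤ n e / n d := csSup_le hSne (by
      rintro _ ⟨n', ⟨hn', hd'⟩, rfl⟩; exact hcmp n hn hnd n' hn' hd')
    rw [le_div_iff₀ hnd] at this
    linarith

lemma exists_dual_pair {m n : Plane →L[ℝ] ℝ} (hm : m ≠ 0) {d : Plane} (hmd : m d = 0)
    (hnd : n d ≠ 0) : ∃ e₁ e₂ : Plane, m e₁ = 1 ∧ m e₂ = 0 ∧ n e₁ = 0 ∧ n e₂ = 1 := by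
  obtain ⟨e, he⟩ := exists_apply_eq_one hm
  exact ⟨e - (n e / n d) • d, (n d)⁻¹ • d, by simp [he, hmd], by simp [hmd],
    by simp [hnd], by simp [hnd]⟩

lemma eq_add_of_dual_pair {m n : Plane →L[ℝ] ℝ} {e₁ e₂ : Plane} (h11 : m e₁ = 1) (h12 : m e₂ = 0)
    (h21 : n e₁ = 0) (h22 : n e₂ = 1) (x : Plane) : x = m x • e₁ + n x • e₂ := by
  have h2 : e₂ ≠ 0 := by rintro rfl; simp at h22
  obtain ⟨r, hr⟩ := eq_smul_add_smul h11 h2 h12 x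
  have := congrArg n hr
  simp only [map_add, map_smul, h21, h22, smul_eq_mul, mul_zero, zero_add, mul_one] at this
  rw [this]; exact hr

end Plane

/-! ### The value three for other bodies -/

/-- Near a smooth boundary point with normal `n`, a convex body can be placed such that it contains
small multiples of `v` and `v'` but not the origin, if `n` is negative at `v` and `v'`. -/
lemma IsRegularNormal.exists_translate {C : Set Plane} (hC : Convex ℝ C) {n : Plane →L[ℝ] ℝ}
    (hn : IsRegularNormal C n) {v v' : Plane} (hv : n v < 0) (hv' : n v' < 0) :
    ∃ ε₀ : ℝ, 0 < ε₀ ∧ ∀ ε : ℝ, 0 < ε → ε ≤ ε₀ →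
      ∃ w, ε • v + w ∈ C ∧ ε • v' + w ∈ C ∧ (0 : Plane) + w ∉ C := by
  obtain ⟨h0, x, hx, hmax, hreg⟩ := hn
  obtain ⟨u, hu⟩ := Plane.exists_apply_eq_one h0
  obtain ⟨ε₁, h1, hε₁⟩ := hreg v hv
  obtain ⟨ε₂, h2, hε₂⟩ := hreg v' hv'
  have key : ∀ d (r ε : ℝ), 0 < r → x + r • d ∈ interior C → 0 < ε → ε ≤ r →
      ∀ᶠ δ in 𝓝[>] (0 : ℝ), ε • d + (x + δ • u) ∈ C := by
    intro d r ε hr hd hε hεr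
    have hint : x + ε • d ∈ interior C := by
      have := hC.add_smul_mem_interior hx hd (t := ε / r)
        ⟨by positivity, by rw [div_le_one hr]; exact hεr⟩
      rwa [smul_smul, div_mul_cancel₀ _ hr.ne'] at this
    have hcont : Continuous fun δ : ℝ => ε • d + (x + δ • u) := by fun_prop
    have : ∀ᶠ δ in 𝓝 (0 : ℝ), ε • d + (x + δ • u) ∈ interior C := by
      refine hcont.continuousAt.eventually (isOpen_interior.mem_nhds ?_)
      convert hint using 1
      module
    exact nhdsWithin_le_nhds (this.mono fun _ h => interior_subset h)
  refine ⟨min ε₁ ε₂, lt_min h1 h2, fun ε hε hεm => ?_⟩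
  obtain ⟨δ, ⟨hδ1, hδ2⟩, hδ⟩ := (((key v ε₁ ε h1 hε₁ hε (hεm.trans (min_le_left _ _))).and
    (key v' ε₂ ε h2 hε₂ hε (hεm.trans (min_le_right _ _)))).and self_mem_nhdsWithin).exists
  have hδ : 0 < δ := hδ
  -- This shift takes the origin just above the top point `x`, with `δ` so small that the two other
  -- points stay in `C`.
  refine ⟨x + δ • u, hδ1, hδ2, fun h => ?_⟩
  have := hmax _ h
  simp only [map_add, map_zero, map_smul, hu, smul_eq_mul] at this
  linarith

/-- If three normals at smooth boundary points of a convex body, not all parallel, add up to zero,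
then the ball Carathéodory number is three. -/
lemma IsConvexBody.ballCaratheodoryNumber_eq_three {C : Set Plane} (hC : IsConvexBody C)
    {n₁ n₂ : Plane →L[ℝ] ℝ} (h₁ : IsRegularNormal C n₁) (h₂ : IsRegularNormal C n₂)
    (h₃ : IsRegularNormal C (-(n₁ + n₂))) {d : Plane} (hd₁ : n₁ d = 0) (hd₂ : n₂ d ≠ 0) :
    ballCaratheodoryNumber C = 3 := by
  obtain ⟨e₁, e₂, h11, h12, h21, h22⟩ := Plane.exists_dual_pair h₁.1 hd₁ hd₂
  -- A triangle with centroid `0` whose edges lie on the lines where `n₁`, `n₂` and `-(n₁ + n₂)`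
  -- equal `-1`.
  set a : Plane := (-1 : ℝ) • e₁ + (2 : ℝ) • e₂ with ha
  set b : Plane := (-1 : ℝ) • e₁ + (-1 : ℝ) • e₂ with hb
  set c : Plane := (2 : ℝ) • e₁ + (-1 : ℝ) • e₂ with hc
  have ha1 : n₁ a = -1 := by simp [ha, h11, h12]
  have ha2 : n₂ a = 2 := by simp [ha, h21, h22]
  have hb1 : n₁ b = -1 := by simp [hb, h11, h12]
  have hb2 : n₂ b = -1 := by simp [hb, h21, h22]
  have hc1 : n₁ c = 2 := by simp [hc, h11, h12]
  have hc2 : n₂ c = -1 := by simp [hc, h21, h22]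
  obtain ⟨r₁, hr₁, H₁⟩ := h₁.exists_translate hC.2.1 (v := a) (v' := b) (by rw [ha1]; norm_num)
    (by rw [hb1]; norm_num)
  obtain ⟨r₂, hr₂, H₂⟩ := h₂.exists_translate hC.2.1 (v := b) (v' := c) (by rw [hb2]; norm_num)
    (by rw [hc2]; norm_num)
  obtain ⟨r₃, hr₃, H₃⟩ := h₃.exists_translate hC.2.1 (v := a) (v' := c)
    (by simp only [neg_apply, add_apply, ha1, ha2]; norm_num)
    (by simp only [neg_apply, add_apply, hc1, hc2]; norm_num)
  set ε := min r₁ (min r₂ r₃) with hε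
  have hε0 : 0 < ε := by positivity
  obtain ⟨w₁, H₁⟩ := H₁ ε hε0 (min_le_left _ _)
  obtain ⟨w₂, H₂⟩ := H₂ ε hε0 ((min_le_right _ _).trans (min_le_left _ _))
  obtain ⟨w₃, H₃⟩ := H₃ ε hε0 ((min_le_right _ _).trans (min_le_right _ _))
  have hne {x y : Plane} (n : Plane →L[ℝ] ℝ) (h : n x ≠ n y) : ε • x ≠ ε • y := by
    intro heq
    exact h (congrArg n (smul_right_injective Plane hε0.ne' heq))
  refine ballCaratheodoryNumber_eq (k := 3) three_pos
    (fun V hV hne p hp => exists_three_points hC hV hne hp)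
    (V := {ε • a, ε • b, ε • c}) (p := 0) (toFinite _).isClosed (by simp) ?_ ?_
  · refine mem_translateHull.2 fun w hw => ?_
    have := hC.2.1.combo3_mem (hw (ε • a) (by simp)) (hw (ε • b) (by simp)) (hw (ε • c) (by simp))
      (b := 1 / 3) (c := 1 / 3) (by norm_num) (by norm_num) (by norm_num)
    convert this using 1
    rw [ha, hb, hc]; module
  · intro W hW _ hcard hmem
    have hmem := mem_translateHull.1 hmem
    by_cases haW : ε • a ∈ W
    · by_cases hbW : ε • b ∈ W
      · by_cases hcW : ε • c ∈ W
        · have hWV : W = {ε • a, ε • b, ε • c} := by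
            refine subset_antisymm hW ?_
            rintro x (rfl | rfl | rfl) <;> assumption
          have : W.encard = 3 := encard_eq_three.2 ⟨_, _, _, hne n₂ (by rw [ha2, hb2]; norm_num),
            hne n₁ (by rw [ha1, hc1]; norm_num), hne n₁ (by rw [hb1, hc1]; norm_num), hWV⟩
          rw [this] at hcard
          exact lt_irrefl _ hcard
        · refine H₁.2.2 (hmem w₁ fun x hx => ?_)
          rcases hW hx with rfl | rfl | rfl
          · exact H₁.1
          · exact H₁.2.1
          · exact absurd hx hcW
      · refine H₃.2.2 (hmem w₃ fun x hx => ?_)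
        rcases hW hx with rfl | rfl | rfl
        · exact H₃.1
        · exact absurd hx hbW
        · exact H₃.2.1
    · refine H₂.2.2 (hmem w₂ fun x hx => ?_)
      rcases hW hx with rfl | rfl | rfl
      · exact absurd hx haW
      · exact H₂.1
      · exact H₂.2.1

/-- A convex body is a parallelogram if all its normals at smooth boundary points are multiples of
one of two functionals `m` and `n`. -/
lemma IsConvexBody.isParallelogram {C : Set Plane} (hC : IsConvexBody C) {m n : Plane →L[ℝ] ℝ}
    {e₁ e₂ : Plane} (h11 : m e₁ = 1) (h12 : m e₂ = 0) (h21 : n e₁ = 0) (h22 : n e₂ = 1)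
    (hN : ∀ k, IsRegularNormal C k → k e₁ = 0 ∨ k e₂ = 0) : IsParallelogram C := by
  have hdec := Plane.eq_add_of_dual_pair h11 h12 h21 h22
  have hCne : C.Nonempty := hC.2.2.mono interior_subset
  obtain ⟨l₁, hl₁C, hl₁⟩ := hC.1.exists_isMinOn hCne m.continuous.continuousOn
  obtain ⟨u₁, hu₁C, hu₁⟩ := hC.1.exists_isMaxOn hCne m.continuous.continuousOn
  obtain ⟨l₂, hl₂C, hl₂⟩ := hC.1.exists_isMinOn hCne n.continuous.continuousOn
  obtain ⟨u₂, hu₂C, hu₂⟩ := hC.1.exists_isMaxOn hCne n.continuous.continuousOn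
  replace hl₁ : ∀ x ∈ C, m l₁ ≤ m x := fun x hx => hl₁ hx
  replace hu₁ : ∀ x ∈ C, m x ≤ m u₁ := fun x hx => hu₁ hx
  replace hl₂ : ∀ x ∈ C, n l₂ ≤ n x := fun x hx => hl₂ hx
  replace hu₂ : ∀ x ∈ C, n x ≤ n u₂ := fun x hx => hu₂ hx
  set B : Set Plane := {x | (m l₁ ≤ m x ∧ m x ≤ m u₁) ∧ (n l₂ ≤ n x ∧ n x ≤ n u₂)} with hB
  have hCB : C ⊆ B := fun x hx => ⟨⟨hl₁ x hx, hu₁ x hx⟩, hl₂ x hx, hu₂ x hx⟩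
  have hBconv : Convex ℝ B := by
    have hI (k : Plane →L[ℝ] ℝ) (r s : ℝ) : Convex ℝ {x | r ≤ k x ∧ k x ≤ s} :=
      (convex_Icc r s).linear_preimage k.toLinearMap
    exact (hI m _ _).inter (hI n _ _)
  have hBint : (interior B).Nonempty := hC.2.2.mono (interior_mono hCB)
  have hBC : B ⊆ C := by
    intro x hx
    by_contra hxC
    have hxcl : x ∈ closure (interior B) := by
      rw [hBconv.closure_interior_eq_closure_of_nonempty_interior hBint]; exact subset_closure hx
    -- `k` is a multiple of `m` or `n`, so its maximum over the box `B` is attained on `C`, and it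
    -- cannot separate `p ∈ B` from `C`.
    obtain ⟨p, ⟨hpB, -⟩, k, hk, hsep⟩ := hC.exists_regularNormal (O := interior B ∩ Cᶜ)
      (isOpen_interior.inter hC.1.isClosed.isOpen_compl)
      (by rw [inter_comm]; exact mem_closure_iff.1 hxcl _ hC.1.isClosed.isOpen_compl hxC)
      (disjoint_compl_left.mono_left inter_subset_right)
    obtain ⟨⟨b1, b2⟩, b3, b4⟩ := interior_subset hpB
    have hkdec (x : Plane) : k x = m x * k e₁ + n x * k e₂ := by
      conv_lhs => rw [hdec x]
      simp
    rcases hN k hk with h | h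
    · have h1 := hsep _ hl₂C
      have h2 := hsep _ hu₂C
      rw [hkdec p, h, mul_zero, zero_add] at h1 h2
      rw [hkdec, h, mul_zero, zero_add] at h1 h2
      rcases le_total 0 (k e₂) with h3 | h3 <;> nlinarith
    · have h1 := hsep _ hl₁C
      have h2 := hsep _ hu₁C
      rw [hkdec p, h, mul_zero, add_zero] at h1 h2
      rw [hkdec, h, mul_zero, add_zero] at h1 h2
      rcases le_total 0 (k e₁) with h3 | h3 <;> nlinarith
  have hpos (k : Plane →L[ℝ] ℝ) (e : Plane) (hk : k e = 1) (l u : Plane)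
      (hl : ∀ x ∈ C, k l ≤ k x) (hu : ∀ x ∈ C, k x ≤ k u) : 0 < k u - k l := by
    obtain ⟨c, hc⟩ := hC.2.2
    have hcont : Continuous fun δ : ℝ => c + δ • e := by fun_prop
    have : ∀ᶠ δ in 𝓝 (0 : ℝ), c + δ • e ∈ interior C :=
      hcont.continuousAt.eventually (isOpen_interior.mem_nhds (by simpa using hc))
    obtain ⟨δ, hδ, hδ0⟩ := ((this.filter_mono nhdsWithin_le_nhds).and
      (self_mem_nhdsWithin : Ioi (0 : ℝ) ∈ 𝓝[>] 0)).exists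
    have hδ0 : 0 < δ := hδ0
    have h1 := hu _ (interior_subset hδ)
    have h2 := hl _ (interior_subset hc)
    rw [map_add, map_smul, hk, smul_eq_mul] at h1
    linarith
  have p1 := hpos m e₁ h11 l₁ u₁ hl₁ hu₁
  have p2 := hpos n e₂ h22 l₂ u₂ hl₂ hu₂
  refine ⟨m l₁ • e₁ + n l₂ • e₂, (m u₁ - m l₁) • e₁, (n u₂ - n l₂) • e₂, ?_, ?_⟩
  · rw [LinearIndependent.pair_iff]
    intro s t hst
    have h1 := congrArg m hst
    have h2 := congrArg n hst
    simp only [map_add, map_smul, h11, h12, h21, h22, smul_eq_mul, map_zero, mul_zero, mul_one,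
      add_zero, zero_add, mul_eq_zero, p1.ne', p2.ne', or_false] at h1 h2
    exact ⟨h1, h2⟩
  · ext x
    rw [show x ∈ C ↔ x ∈ B from ⟨fun h => hCB h, fun h => hBC h⟩,
      Set.mem_vadd_set_iff_neg_vadd_mem, mem_parallelepiped_iff]
    simp only [vadd_eq_add, Fin.sum_univ_two, Matrix.cons_val_zero, Matrix.cons_val_one]
    constructor
    · rintro ⟨⟨b1, b2⟩, b3, b4⟩
      refine ⟨![(m x - m l₁) / (m u₁ - m l₁), (n x - n l₂) / (n u₂ - n l₂)], ⟨?_, ?_⟩, ?_⟩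
      · intro i
        fin_cases i
        · exact div_nonneg (by linarith) p1.le
        · exact div_nonneg (by linarith) p2.le
      · intro i
        fin_cases i
        · exact (div_le_one p1).2 (by linarith)
        · exact (div_le_one p2).2 (by linarith)
      · simp only [Matrix.cons_val_zero, Matrix.cons_val_one, smul_smul]
        rw [div_mul_cancel₀ _ p1.ne', div_mul_cancel₀ _ p2.ne']
        conv_lhs => rw [hdec x]
        module
    · rintro ⟨t, ⟨ht0, ht1⟩, hx⟩
      have hx1 := congrArg m hx
      have hx2 := congrArg n hx
      simp only [map_add, map_neg, map_smul, h11, h12, h21, h22, smul_eq_mul, mul_zero, mul_one,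
        add_zero, zero_add] at hx1 hx2
      have t0 : 0 ≤ t 0 := ht0 0
      have t1 : 0 ≤ t 1 := ht0 1
      have t2 : t 0 ≤ 1 := ht1 0
      have t3 : t 1 ≤ 1 := ht1 1
      refine ⟨⟨?_, ?_⟩, ?_, ?_⟩ <;> nlinarith

/-- A convex body that is not a parallelogram has three normals at smooth boundary points, not all
parallel, that add up to zero. -/
lemma IsConvexBody.exists_triple {C : Set Plane} (hC : IsConvexBody C) (hP : ¬ IsParallelogram C) :
    ∃ n₁ n₂ : Plane →L[ℝ] ℝ, IsRegularNormal C n₁ ∧ IsRegularNormal C n₂ ∧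
      IsRegularNormal C (-(n₁ + n₂)) ∧ ∃ d, n₁ d = 0 ∧ n₂ d ≠ 0 := by
  by_contra! hno
  apply hP
  have hneg : ∀ m, IsRegularNormal C m → IsRegularNormal C (-m) := fun m hm =>
    Plane.neg_mem_of_no_triple (N := {n | IsRegularNormal C n}) (fun n hn => hn.1)
      (fun n hn r hr => hn.smul hr) (fun d hd => hC.exists_regularNormal_pos hd)
      (fun n₁ h₁ n₂ h₂ => hno n₁ n₂ h₁ h₂) hm
  have hsmul : ∀ m, IsRegularNormal C m → ∀ r : ℝ, r ≠ 0 → IsRegularNormal C (r • m) := by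
    intro m hm r hr
    rcases hr.lt_or_gt with hr | hr
    · have := (hneg m hm).smul (neg_pos.2 hr)
      convert this using 1
      ext x; simp
    · exact hm.smul hr
  obtain ⟨m, hm, -⟩ := hC.exists_regularNormal_pos
    (d := EuclideanSpace.single (0 : Fin 2) (1 : ℝ)) (by simp)
  obtain ⟨d, hd, hmd⟩ := Plane.exists_ne_zero_apply_eq_zero m
  obtain ⟨n, hn, hnd⟩ := hC.exists_regularNormal_pos hd
  obtain ⟨e₁, e₂, h11, h12, h21, h22⟩ := Plane.exists_dual_pair hm.1 hmd hnd.ne'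
  refine hC.isParallelogram h11 h12 h21 h22 fun k hk => ?_
  by_contra! hke
  -- Since `k = k e₁ • m + k e₂ • n` and the normals are closed under all nonzero scalars, `k` would
  -- complete a triple with sum zero.
  have := hno (-k e₁ • m) (-k e₂ • n) (hsmul m hm _ (neg_ne_zero.2 hke.1))
    (hsmul n hn _ (neg_ne_zero.2 hke.2)) (by
      convert hk using 1
      ext x
      conv_rhs => rw [Plane.eq_add_of_dual_pair h11 h12 h21 h22 x]
      simp
      ring) e₂ (by simp [h12])
  simp [h22, hke.2] at this

theorem mainTheorem6 (C : Set (EuclideanSpace ℝ (Fin 2))) (hC : IsConvexBody C) :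
    (IsParallelogram C →
      spindleCaratheodoryNumber C = 2 ∧ ballCaratheodoryNumber C = 2) ∧
    (¬ IsParallelogram C →
      spindleCaratheodoryNumber C = 3 ∧ ballCaratheodoryNumber C = 3) := by
  rw [spindleCaratheodoryNumber_eq hC]
  refine ⟨fun hP => ?_, fun hP => ?_⟩
  · have := hP.ballCaratheodoryNumber_eq_two hC
    exact ⟨this, this⟩
  · obtain ⟨n₁, n₂, h₁, h₂, h₃, d, hd₁, hd₂⟩ := hC.exists_triple hP
    have := hC.ballCaratheodoryNumber_eq_three h₁ h₂ h₃ hd₁ hd₂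
    exact ⟨this, this⟩
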